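/- Let $\Psi\mathrm{Dif}_1$ be the associative algebra of formal pseudo-differential operators $\sum_{i\le N}a_i(x)\,\partial^i$ with $a_i\in\mathbb C[x,x^{-1}]$, where $\partial=d/dx$, and let $\operatorname{res}$ be the noncommutative residue, that is, the coefficient at $x^{-1}\partial^{-1}$. Put $D_1=\operatorname{ad}(\ln\partial)$, $D_2=\operatorname{ad}(\ln x)$, that is, $$D_1(a\partial^i)=\sum_{n\ge1}\tfrac{(-1)^{n-1}}{n}a^{(n)}\partial^{i-n},\qquad D_2(a\partial^i)=-\sum_{n\ge1}\tbinom in(-1)^{n-1}(n-1)!\,a\,x^{-n}\partial^{i-n},$$ and $Q=\sum_{n\ge1}\frac{(n-1)!}{n}x^{-n}\partial^{-n}$, so that $[D_1,D_2]=\operatorname{ad}Q$. Let these act entrywise on infinite matrices over $\Psi\mathrm{Dif}_1$ ($Q$ as $\mathrm{Id}\otimes Q$), let $\operatorname{Tr}$ of such a matrix be the residue of its diagonal sum, and for $k\ge1$ let $\Psi_{2k+1}$ be the lifting cochain $$\Psi_{2k+1}(A_1,\dots,A_{2k+1})=\operatorname{Alt}_A\operatorname{Tr}(Q A_1\cdots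 A_{2k+1})+\sum_{s\ge1}w_s\operatorname{Alt}_{A,D}\operatorname{Tr}(D_1A_1\cdot A_2\cdots A_{2s-1}\cdot D_2A_{2s}\cdot A_{2s+1}\cdots A_{2k+1}),$$ where $w_s=1$ if $2s\le k+1$, $w_s=\frac12$ if $2s=k+2$, $w_s=0$ otherwise, and $\operatorname{Alt}$ is the signed sum over all permutations (of the $A_i$, respectively of the $A_i$ and of $D_1,D_2$), without normalizing factor; it is evaluated on row- and column-finite infinite matrices, at least one of which has finitely many nonzero entries. Let $\mathfrak{gl}_\infty^{\mathrm{fin}}$ be the Lie algebra of infinite complex matrices with finitely many nonzero entries, embedded by $A\mapsto A\otimes1$. Then for every $k\ge1$ the cochain $$(A_1,\dots,A_{2k-1})\mapsto\Psi_{2k+1}(\mathrm{Id}\otimes\partial,\ \mathrm{Id}\otimes x^2\partial,\ A_1\otimes1,\dots,A_{2k-1}\otimes1)$$ has a nonzero value on some $(2k-1)$-cycle $\sum_iA_1^{(i)}\wedge\dots\wedge A_{2k-1}^{(i)}$ of the Chevalley–Eilenberg complex of $\mathfrak{gl}_\infty^{\mathrm{fin}}$ with trivial coefficients. More precisely, its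 value on every $(2k-1)$-chain $\sum_iA_1^{(i)}\wedge\dots\wedge A_{2k-1}^{(i)}$, in particular on every cycle, is $$-(2k+1)\cdot\operatorname{tr}\Bigl(\sum_i\operatorname{Alt}\bigl(A_1^{(i)}\cdots A_{2k-1}^{(i)}\bigr)\Bigr).$$ For $k=1$ one has $\Psi_3(\mathrm{Id}\otimes\partial,\mathrm{Id}\otimes x^2\partial,E_{11}\otimes1)=-3$. -/

import Mathlib

open scoped LaurentPolynomial

noncomputable section

namespace PsiDif

/-- `d/dx` on Laurent polynomials in `x`, as a linear map: `x ^ n ↦ n x ^ (n - 1)`. -/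
def dxLin : ℂ[T;T⁻¹] →ₗ[ℂ] ℂ[T;T⁻¹] :=
  (Finsupp.lsum ℂ fun n : ℤ =>
      LinearMap.toSpanSingleton ℂ ℂ[T;T⁻¹] (AddMonoidAlgebra.single (n - 1) (n : ℂ))) ∘ₗ
    (AddMonoidAlgebra.coeffLinearEquiv ℂ : ℂ[T;T⁻¹] ≃ₗ[ℂ] (ℤ →₀ ℂ)).toLinearMap

theorem dxLin_single (n : ℤ) (a : ℂ) :
    dxLin (AddMonoidAlgebra.single n a) = AddMonoidAlgebra.single (n - 1) (a * n) := by
  simp only [dxLin, LinearMap.comp_apply, LinearEquiv.coe_coe,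
    AddMonoidAlgebra.coeffLinearEquiv_apply, AddMonoidAlgebra.coeff_single]
  rw [Finsupp.lsum_single, LinearMap.toSpanSingleton_apply, AddMonoidAlgebra.smul_single,
    smul_eq_mul]

/-- `d/dx` as a derivation of the algebra of Laurent polynomials in `x`. -/
def dx : Derivation ℂ ℂ[T;T⁻¹] ℂ[T;T⁻¹] :=
  Derivation.mk' dxLin (by
    intro f g
    simp only [smul_eq_mul]
    induction f using AddMonoidAlgebra.induction_linear with
    | zero => simp
    | add f₁ f₂ h₁ h₂ => simp only [add_mul, map_add, h₁, h₂, mul_add]; ring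
    | single m a =>
      induction g using AddMonoidAlgebra.induction_linear with
      | zero => simp
      | add f₁ f₂ h₁ h₂ => simp only [mul_add, map_add, h₁, h₂, add_mul]; ring
      | single n b =>
        rw [AddMonoidAlgebra.single_mul_single, dxLin_single, dxLin_single, dxLin_single,
          AddMonoidAlgebra.single_mul_single, AddMonoidAlgebra.single_mul_single,
          show m + (n - 1) = m + n - 1 by ring, show n + (m - 1) = m + n - 1 by ring,
          ← AddMonoidAlgebra.single_add]
        congr 1
        push_cast
        ring)

theorem dx_iterate_add (n : ℕ) (a b : ℂ[T;T⁻¹]) : dx^[n] (a + b) = dx^[n] a + dx^[n] b :=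
  iterate_map_add dx n a b

theorem dx_iterate_mul (n : ℕ) (a b : ℂ[T;T⁻¹]) :
    dx^[n] (a * b) =
      ∑ ij ∈ Finset.HasAntidiagonal.antidiagonal n, n.choose ij.1 • (dx^[ij.1] a * dx^[ij.2] b) := by
  induction n with
  | zero => simp
  | succ n ih =>
    rw [Finset.sum_antidiagonal_choose_succ_nsmul (fun i j => dx^[i] a * dx^[j] b) n]
    simp only [Function.iterate_succ_apply', ih, map_sum, map_nsmul, Derivation.leibniz, smul_add,
      Finset.sum_add_distrib, smul_eq_mul]
    congr 1
    refine Finset.sum_congr rfl fun ⟨i, j⟩ hij ↦ ?_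
    rw [n.choose_symm_of_eq_add (Finset.HasAntidiagonal.mem_antidiagonal.1 hij).symm, mul_comm]

end PsiDif

open PsiDif

/-- A formal pseudo-differential operator on the circle: a formal series `∑ i, aᵢ(x) ∂ ^ i` with
`aᵢ` a Laurent polynomial in `x` and `aᵢ = 0` for all large `i`. -/
@[ext]
structure PsiDif where
  coeff : ℤ → ℂ[T;T⁻¹]
  bounded : ∃ N : ℤ, ∀ i, N < i → coeff i = 0

namespace PsiDif

theorem coeff_injective : Function.Injective PsiDif.coeff := fun _ _ h => PsiDif.ext h

instance : Zero PsiDif := ⟨⟨0, 0, fun _ _ => rfl⟩⟩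

instance : Add PsiDif :=
  ⟨fun P Q => ⟨P.coeff + Q.coeff, by
    obtain ⟨N, hN⟩ := P.bounded
    obtain ⟨M, hM⟩ := Q.bounded
    exact ⟨max N M, fun i hi => by
      simp [hN i (lt_of_le_of_lt (le_max_left _ _) hi),
        hM i (lt_of_le_of_lt (le_max_right _ _) hi)]⟩⟩⟩

instance : Neg PsiDif :=
  ⟨fun P => ⟨-P.coeff, by
    obtain ⟨N, hN⟩ := P.bounded
    exact ⟨N, fun i hi => by simp [hN i hi]⟩⟩⟩

instance : Sub PsiDif :=
  ⟨fun P Q => ⟨P.coeff - Q.coeff, by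
    obtain ⟨N, hN⟩ := P.bounded
    obtain ⟨M, hM⟩ := Q.bounded
    exact ⟨max N M, fun i hi => by
      simp [hN i (lt_of_le_of_lt (le_max_left _ _) hi),
        hM i (lt_of_le_of_lt (le_max_right _ _) hi)]⟩⟩⟩

instance {S : Type*} [Monoid S] [DistribMulAction S ℂ[T;T⁻¹]] : SMul S PsiDif :=
  ⟨fun c P => ⟨c • P.coeff, by
    obtain ⟨N, hN⟩ := P.bounded
    exact ⟨N, fun i hi => by simp [hN i hi]⟩⟩⟩

instance : AddCommGroup PsiDif :=
  coeff_injective.addCommGroup _ rfl (fun _ _ => rfl) (fun _ => rfl) (fun _ _ => rfl)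
    (fun _ _ => rfl) (fun _ _ => rfl)

/-- The coefficients as an additive map. -/
def coeffHom : PsiDif →+ (ℤ → ℂ[T;T⁻¹]) where
  toFun := coeff
  map_zero' := rfl
  map_add' _ _ := rfl

instance : Module ℂ PsiDif :=
  coeff_injective.module ℂ coeffHom fun _ _ => rfl

/-- The operator `a(x) ∂ ^ n`. -/
def monomial (n : ℤ) (a : ℂ[T;T⁻¹]) : PsiDif :=
  ⟨Pi.single n a, n, fun _ hi => Pi.single_eq_of_ne (ne_of_gt hi) _⟩

instance : One PsiDif := ⟨monomial 0 1⟩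

/-- The contribution of `(a ∂ ^ i) (b ∂ ^ j)` to the coefficient at `∂ ^ m`. -/
def term (i j m : ℤ) (a b : ℂ[T;T⁻¹]) : ℂ[T;T⁻¹] :=
  if m ≤ i + j then
    Ring.choose i (i + j - m).toNat • (a * dx^[(i + j - m).toNat] b) else 0

theorem term_zero_left (i j m : ℤ) (b : ℂ[T;T⁻¹]) : term i j m 0 b = 0 := by
  simp [term]

theorem term_zero_right (i j m : ℤ) (a : ℂ[T;T⁻¹]) : term i j m a 0 = 0 := by
  simp [term, iterate_map_zero]

theorem term_add_left (i j m : ℤ) (a a' b : ℂ[T;T⁻¹]) :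
    term i j m (a + a') b = term i j m a b + term i j m a' b := by
  unfold term; split_ifs <;> simp [add_mul]

theorem term_add_right (i j m : ℤ) (a b b' : ℂ[T;T⁻¹]) :
    term i j m a (b + b') = term i j m a b + term i j m a b' := by
  unfold term; split_ifs <;> simp [mul_add, iterate_map_add]

theorem term_sum_left {ι : Type*} (s : Finset ι) (i j m : ℤ) (f : ι → ℂ[T;T⁻¹]) (b : ℂ[T;T⁻¹]) :
    term i j m (∑ t ∈ s, f t) b = ∑ t ∈ s, term i j m (f t) b :=
  map_sum (AddMonoidHom.mk' (fun a => term i j m a b) fun _ _ => term_add_left ..) f s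

theorem term_sum_right {ι : Type*} (s : Finset ι) (i j m : ℤ) (a : ℂ[T;T⁻¹]) (f : ι → ℂ[T;T⁻¹]) :
    term i j m a (∑ t ∈ s, f t) = ∑ t ∈ s, term i j m a (f t) :=
  map_sum (AddMonoidHom.mk' (fun b => term i j m a b) fun _ _ => term_add_right ..) f s

/-- The coefficient at `∂ ^ m` of the product is
`∑ᵢ ∑ₙ (i choose n) aᵢ bⱼ⁽ⁿ⁾` with `i + j - n = m`, from
`∂ ^ i ∘ b = ∑ₙ (i choose n) b⁽ⁿ⁾ ∂ ^ (i - n)`; all but finitely many terms vanish. -/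
def mulCoeff (P Q : PsiDif) (m : ℤ) : ℂ[T;T⁻¹] :=
  ∑ᶠ p : ℤ × ℕ,
    Ring.choose p.1 p.2 • (P.coeff p.1 * dx^[p.2] (Q.coeff (m - p.1 + p.2)))

theorem mulCoeff_eq_sum (P Q : PsiDif) (m : ℤ) (I J : Finset ℤ)
    (h : ∀ i j, m ≤ i + j → P.coeff i ≠ 0 → Q.coeff j ≠ 0 → i ∈ I ∧ j ∈ J) :
    mulCoeff P Q m = ∑ i ∈ I, ∑ j ∈ J, term i j m (P.coeff i) (Q.coeff j) := by
  classical
  set f : ℤ × ℕ → ℂ[T;T⁻¹] := fun p =>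
    Ring.choose p.1 p.2 • (P.coeff p.1 * dx^[p.2] (Q.coeff (m - p.1 + p.2))) with hf
  set s : Finset (ℤ × ℕ) := ((I ×ˢ J).filter fun p => m ≤ p.1 + p.2).image
    fun p => (p.1, (p.1 + p.2 - m).toNat) with hs
  have hsupp : Function.support f ⊆ s := by
    rintro ⟨i, n⟩ hp
    have h1 : P.coeff i ≠ 0 := by
      intro h0; apply hp; simp [hf, h0]
    have h2 : Q.coeff (m - i + n) ≠ 0 := by
      intro h0; apply hp; simp [hf, h0, iterate_map_zero]
    have h3 := h i (m - i + n) (by omega) h1 h2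
    simp only [hs, Finset.coe_image, Set.mem_image, Finset.mem_coe, Finset.mem_filter,
      Finset.mem_product]
    refine ⟨(i, m - i + n), ⟨h3, by simp only; omega⟩, ?_⟩
    simp only [Prod.mk.injEq, true_and]
    omega
  rw [mulCoeff, finsum_eq_sum_of_support_subset f hsupp, hs, Finset.sum_image, Finset.sum_filter,
    Finset.sum_product]
  · refine Finset.sum_congr rfl fun i _ => Finset.sum_congr rfl fun j _ => ?_
    unfold term
    split_ifs with hij
    · have : m - i + ((i + j - m).toNat : ℤ) = j := by omega
      simp only [hf, this]
    · rfl
  · rintro ⟨i, j⟩ hij ⟨i', j'⟩ hij' heq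
    simp only [Finset.coe_filter, Set.mem_ofPred_eq] at hij hij'
    simp only [Prod.mk.injEq] at heq ⊢
    obtain ⟨rfl, h2⟩ := heq
    exact ⟨rfl, by omega⟩

theorem mulCoeff_eq_zero (P Q : PsiDif) (N M : ℤ) (hN : ∀ i, N < i → P.coeff i = 0)
    (hM : ∀ i, M < i → Q.coeff i = 0) (m : ℤ) (hm : N + M < m) : mulCoeff P Q m = 0 := by
  rw [mulCoeff_eq_sum P Q m ∅ ∅]
  · simp
  · intro i j hij hi hj
    have h1 : i ≤ N := not_lt.1 fun h => hi (hN i h)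
    have h2 : j ≤ M := not_lt.1 fun h => hj (hM j h)
    omega

theorem mulCoeff_eq_box (P Q : PsiDif) (N M : ℤ) (hN : ∀ i, N < i → P.coeff i = 0)
    (hM : ∀ i, M < i → Q.coeff i = 0) (m a b : ℤ) (ha : a ≤ m - M) (hb : b ≤ m - N) :
    mulCoeff P Q m = ∑ i ∈ Finset.Icc a N, ∑ j ∈ Finset.Icc b M,
      term i j m (P.coeff i) (Q.coeff j) := by
  apply mulCoeff_eq_sum
  intro i j hij hi hj
  have h1 : i ≤ N := not_lt.1 fun h => hi (hN i h)
  have h2 : j ≤ M := not_lt.1 fun h => hj (hM j h)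
  simp only [Finset.mem_Icc]
  omega

/-- Composition of pseudo-differential operators. -/
instance : Mul PsiDif :=
  ⟨fun P Q => ⟨mulCoeff P Q, by
    obtain ⟨N, hN⟩ := P.bounded
    obtain ⟨M, hM⟩ := Q.bounded
    exact ⟨N + M, fun m hm => mulCoeff_eq_zero P Q N M hN hM m hm⟩⟩⟩

theorem sum_term_left (i j k m : ℤ) (a b c : ℂ[T;T⁻¹]) (L : Finset ℤ)
    (hL : Finset.Icc (m - k) (i + j) ⊆ L) :
    ∑ l ∈ L, term l k m (term i j l a b) c =
      if m ≤ i + j + k then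
        ∑ nr ∈ Finset.HasAntidiagonal.antidiagonal (i + j + k - m).toNat,
          (Ring.choose i nr.1 * Ring.choose (i + j - nr.1) nr.2) •
            (a * dx^[nr.1] b * dx^[nr.2] c) else 0 := by
  classical
  rw [← Finset.sum_subset hL]
  · split_ifs with h
    · symm
      refine Finset.sum_bij (fun nr _ => i + j - nr.1) ?_ ?_ ?_ ?_
      · rintro ⟨n, r⟩ hnr
        simp only [Finset.HasAntidiagonal.mem_antidiagonal] at hnr
        simp only [Finset.mem_Icc]; omega
      · rintro ⟨n, r⟩ hnr ⟨n', r'⟩ hnr' heq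
        simp only [Finset.HasAntidiagonal.mem_antidiagonal] at hnr hnr' heq
        simp only [Prod.mk.injEq]; omega
      · intro l hl
        simp only [Finset.mem_Icc] at hl
        refine ⟨((i + j - l).toNat, (l + k - m).toNat), ?_, ?_⟩
        · simp only [Finset.HasAntidiagonal.mem_antidiagonal]; omega
        · simp only; omega
      · rintro ⟨n, r⟩ hnr
        simp only [Finset.HasAntidiagonal.mem_antidiagonal] at hnr
        have h1 : (i + j - (i + j - (n : ℤ))).toNat = n := by omega
        have h2 : (i + j - (n : ℤ) + k - m).toNat = r := by omega
        simp only [term]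
        rw [if_pos (by omega), if_pos (by omega), h1, h2, smul_mul_assoc, smul_smul, mul_comm]
    · rw [Finset.Icc_eq_empty (by omega), Finset.sum_empty]
  · intro l _ hl
    simp only [Finset.mem_Icc, not_and_or, not_le] at hl
    rcases hl with hl | hl
    · rw [term, if_neg (by omega)]
    · rw [term.eq_def i j, if_neg (by omega), term_zero_left]

theorem sum_term_right (i j k m : ℤ) (a b c : ℂ[T;T⁻¹]) (L : Finset ℤ)
    (hL : Finset.Icc (m - i) (j + k) ⊆ L) :
    ∑ l ∈ L, term i l m a (term j k l b c) =
      if m ≤ i + j + k then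
        ∑ qt ∈ Finset.HasAntidiagonal.antidiagonal (i + j + k - m).toNat,
          (Ring.choose i qt.2 * Ring.choose j qt.1) •
            (a * dx^[qt.2] (b * dx^[qt.1] c)) else 0 := by
  classical
  rw [← Finset.sum_subset hL]
  · split_ifs with h
    · symm
      refine Finset.sum_bij (fun qt _ => j + k - qt.1) ?_ ?_ ?_ ?_
      · rintro ⟨n, r⟩ hnr
        simp only [Finset.HasAntidiagonal.mem_antidiagonal] at hnr
        simp only [Finset.mem_Icc]; omega
      · rintro ⟨n, r⟩ hnr ⟨n', r'⟩ hnr' heq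
        simp only [Finset.HasAntidiagonal.mem_antidiagonal] at hnr hnr' heq
        simp only [Prod.mk.injEq]; omega
      · intro l hl
        simp only [Finset.mem_Icc] at hl
        refine ⟨((j + k - l).toNat, (i + l - m).toNat), ?_, ?_⟩
        · simp only [Finset.HasAntidiagonal.mem_antidiagonal]; omega
        · simp only; omega
      · rintro ⟨n, r⟩ hnr
        simp only [Finset.HasAntidiagonal.mem_antidiagonal] at hnr
        have h1 : (j + k - (j + k - (n : ℤ))).toNat = n := by omega
        have h2 : (i + (j + k - (n : ℤ)) - m).toNat = r := by omega
        simp only [term]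
        rw [if_pos (by omega), if_pos (by omega), h1, h2]
        have : ∀ (z : ℤ) (u : ℂ[T;T⁻¹]), dx^[r] (z • u) = z • dx^[r] u := fun z u =>
          iterate_map_zsmul dx r u z
        rw [this, mul_smul_comm, smul_smul]
    · rw [Finset.Icc_eq_empty (by omega), Finset.sum_empty]
  · intro l _ hl
    simp only [Finset.mem_Icc, not_and_or, not_le] at hl
    rcases hl with hl | hl
    · rw [term, if_neg (by omega)]
    · rw [term.eq_def j k, if_neg (by omega), term_zero_right]

theorem sum_antidiagonal_assoc {M : Type*} [AddCommMonoid M] (e : ℕ) (f : ℕ → ℕ → ℕ → M) :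
    ∑ nr ∈ Finset.HasAntidiagonal.antidiagonal e, ∑ pq ∈ Finset.HasAntidiagonal.antidiagonal nr.2, f nr.1 pq.1 pq.2 =
      ∑ qt ∈ Finset.HasAntidiagonal.antidiagonal e, ∑ np ∈ Finset.HasAntidiagonal.antidiagonal qt.2, f np.1 np.2 qt.1 := by
  rw [Finset.sum_sigma', Finset.sum_sigma']
  refine Finset.sum_bij'
    (fun x _ => ⟨(x.2.2, x.1.1 + x.2.1), (x.1.1, x.2.1)⟩)
    (fun x _ => ⟨(x.2.1, x.2.2 + x.1.1), (x.2.2, x.1.1)⟩) ?_ ?_ ?_ ?_ ?_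
  all_goals
    rintro ⟨⟨u, v⟩, ⟨w, z⟩⟩ hx
    simp only [Finset.mem_sigma, Finset.HasAntidiagonal.mem_antidiagonal] at hx ⊢
  · exact ⟨by omega, trivial⟩
  · exact ⟨by omega, trivial⟩
  · obtain ⟨h1, rfl⟩ := hx; rfl
  · obtain ⟨h1, rfl⟩ := hx; rfl

theorem monomial_assoc (i j : ℤ) (e : ℕ) (a b c : ℂ[T;T⁻¹]) :
    ∑ nr ∈ Finset.HasAntidiagonal.antidiagonal e,
        (Ring.choose i nr.1 * Ring.choose (i + j - nr.1) nr.2) •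
          (a * dx^[nr.1] b * dx^[nr.2] c) =
      ∑ qt ∈ Finset.HasAntidiagonal.antidiagonal e,
        (Ring.choose i qt.2 * Ring.choose j qt.1) • (a * dx^[qt.2] (b * dx^[qt.1] c)) := by
  have hl : ∀ nr ∈ Finset.HasAntidiagonal.antidiagonal e,
      (Ring.choose i nr.1 * Ring.choose (i + j - nr.1) nr.2) •
          (a * dx^[nr.1] b * dx^[nr.2] c) =
        ∑ pq ∈ Finset.HasAntidiagonal.antidiagonal nr.2,
          (Ring.choose i (nr.1 + pq.1) * ((nr.1 + pq.1).choose nr.1 : ℤ) * Ring.choose j pq.2) •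
            (a * dx^[nr.1] b * dx^[pq.1 + pq.2] c) := by
    rintro ⟨n, r⟩ _
    simp only
    rw [show i + j - (n : ℤ) = (i - n) + j by ring, Ring.add_choose_eq r (Commute.all _ _),
      Finset.mul_sum, Finset.sum_smul]
    refine Finset.sum_congr rfl ?_
    rintro ⟨p, q⟩ hpq
    simp only [Finset.HasAntidiagonal.mem_antidiagonal] at hpq
    have h := Ring.choose_smul_choose i (Nat.le_add_right n p)
    rw [Nat.add_sub_cancel_left, nsmul_eq_mul] at h
    rw [← mul_assoc, ← h]
    simp only [hpq]
    congr 2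
    ring
  have hr : ∀ qt ∈ Finset.HasAntidiagonal.antidiagonal e,
      (Ring.choose i qt.2 * Ring.choose j qt.1) • (a * dx^[qt.2] (b * dx^[qt.1] c)) =
        ∑ np ∈ Finset.HasAntidiagonal.antidiagonal qt.2,
          (Ring.choose i (np.1 + np.2) * ((np.1 + np.2).choose np.1 : ℤ) * Ring.choose j qt.1) •
            (a * dx^[np.1] b * dx^[np.2 + qt.1] c) := by
    rintro ⟨q, t⟩ _
    simp only
    rw [dx_iterate_mul, Finset.mul_sum, Finset.smul_sum]
    refine Finset.sum_congr rfl ?_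
    rintro ⟨n, p⟩ hnp
    simp only [Finset.HasAntidiagonal.mem_antidiagonal] at hnp
    simp only [hnp, Function.iterate_add_apply]
    rw [mul_smul_comm, ← natCast_zsmul, smul_smul, mul_assoc a]
    congr 1
    ring
  rw [Finset.sum_congr rfl hl, Finset.sum_congr rfl hr]
  exact sum_antidiagonal_assoc e fun n p q =>
    (Ring.choose i (n + p) * ((n + p).choose n : ℤ) * Ring.choose j q) •
      (a * dx^[n] b * dx^[p + q] c)

protected theorem mul_assoc' (P Q S : PsiDif) : P * Q * S = P * (Q * S) := by
  obtain ⟨N, hN⟩ := P.bounded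
  obtain ⟨M, hM⟩ := Q.bounded
  obtain ⟨K, hK⟩ := S.bounded
  ext1
  funext m
  have e1 : (P * Q * S).coeff m = ∑ i ∈ Finset.Icc (m - M - K) N,
      ∑ j ∈ Finset.Icc (m - N - K) M, ∑ k ∈ Finset.Icc (m - N - M) K,
        ∑ l ∈ Finset.Icc (m - K) (N + M),
          term l k m (term i j l (P.coeff i) (Q.coeff j)) (S.coeff k) := by
    change mulCoeff (P * Q) S m = _
    rw [mulCoeff_eq_box (P * Q) S (N + M) K
      (fun l hl => mulCoeff_eq_zero P Q N M hN hM l hl) hK m (m - K) (m - N - M) le_rfl (by omega)]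
    have : ∀ l ∈ Finset.Icc (m - K) (N + M), (P * Q).coeff l =
        ∑ i ∈ Finset.Icc (m - M - K) N, ∑ j ∈ Finset.Icc (m - N - K) M,
          term i j l (P.coeff i) (Q.coeff j) := by
      intro l hl
      rw [Finset.mem_Icc] at hl
      exact mulCoeff_eq_box P Q N M hN hM l _ _ (by omega) (by omega)
    rw [Finset.sum_congr rfl fun l hl => by rw [this l hl]]
    simp only [term_sum_left]
    rw [Finset.sum_comm, Finset.sum_congr rfl fun k _ => Finset.sum_comm, Finset.sum_comm]
    refine Finset.sum_congr rfl fun i _ => ?_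
    rw [Finset.sum_congr rfl fun k _ => Finset.sum_comm, Finset.sum_comm]
  have e2 : (P * (Q * S)).coeff m = ∑ i ∈ Finset.Icc (m - M - K) N,
      ∑ j ∈ Finset.Icc (m - N - K) M, ∑ k ∈ Finset.Icc (m - N - M) K,
        ∑ l ∈ Finset.Icc (m - N) (M + K),
          term i l m (P.coeff i) (term j k l (Q.coeff j) (S.coeff k)) := by
    change mulCoeff P (Q * S) m = _
    rw [mulCoeff_eq_box P (Q * S) N (M + K) hN
      (fun l hl => mulCoeff_eq_zero Q S M K hM hK l hl) m (m - M - K) (m - N) (by omega) le_rfl]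
    have : ∀ l ∈ Finset.Icc (m - N) (M + K), (Q * S).coeff l =
        ∑ j ∈ Finset.Icc (m - N - K) M, ∑ k ∈ Finset.Icc (m - N - M) K,
          term j k l (Q.coeff j) (S.coeff k) := by
      intro l hl
      rw [Finset.mem_Icc] at hl
      exact mulCoeff_eq_box Q S M K hM hK l _ _ (by omega) (by omega)
    refine Finset.sum_congr rfl fun i _ => ?_
    rw [Finset.sum_congr rfl fun l hl => by rw [this l hl]]
    simp only [term_sum_right]
    rw [Finset.sum_comm]
    refine Finset.sum_congr rfl fun j _ => ?_
    rw [Finset.sum_comm]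
  rw [e1, e2]
  refine Finset.sum_congr rfl fun i hi => Finset.sum_congr rfl fun j hj =>
    Finset.sum_congr rfl fun k hk => ?_
  rw [Finset.mem_Icc] at hi hj hk
  rw [sum_term_left _ _ _ _ _ _ _ _ (Finset.Icc_subset_Icc (by omega) (by omega)),
    sum_term_right _ _ _ _ _ _ _ _ (Finset.Icc_subset_Icc (by omega) (by omega)), monomial_assoc]

protected theorem left_distrib' (P Q S : PsiDif) : P * (Q + S) = P * Q + P * S := by
  obtain ⟨N, hN⟩ := P.bounded
  obtain ⟨M, hM⟩ := Q.bounded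
  obtain ⟨K, hK⟩ := S.bounded
  have hM' : ∀ i, max M K < i → Q.coeff i = 0 := fun i hi => hM i (lt_of_le_of_lt (le_max_left ..) hi)
  have hK' : ∀ i, max M K < i → S.coeff i = 0 := fun i hi => hK i (lt_of_le_of_lt (le_max_right ..) hi)
  have hs : ∀ i, max M K < i → (Q + S).coeff i = 0 := fun i hi => by
    change Q.coeff i + S.coeff i = 0
    rw [hM' i hi, hK' i hi, add_zero]
  ext1
  funext m
  change mulCoeff P (Q + S) m = mulCoeff P Q m + mulCoeff P S m
  rw [mulCoeff_eq_box P _ N _ hN hs m _ _ le_rfl le_rfl,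
    mulCoeff_eq_box P _ N _ hN hM' m _ _ le_rfl le_rfl,
    mulCoeff_eq_box P _ N _ hN hK' m _ _ le_rfl le_rfl]
  simp only [← Finset.sum_add_distrib, ← term_add_right]
  rfl

protected theorem right_distrib' (P Q S : PsiDif) : (P + Q) * S = P * S + Q * S := by
  obtain ⟨N, hN⟩ := S.bounded
  obtain ⟨M, hM⟩ := P.bounded
  obtain ⟨K, hK⟩ := Q.bounded
  have hM' : ∀ i, max M K < i → P.coeff i = 0 := fun i hi => hM i (lt_of_le_of_lt (le_max_left ..) hi)
  have hK' : ∀ i, max M K < i → Q.coeff i = 0 := fun i hi => hK i (lt_of_le_of_lt (le_max_right ..) hi)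
  have hs : ∀ i, max M K < i → (P + Q).coeff i = 0 := fun i hi => by
    change P.coeff i + Q.coeff i = 0
    rw [hM' i hi, hK' i hi, add_zero]
  ext1
  funext m
  change mulCoeff (P + Q) S m = mulCoeff P S m + mulCoeff Q S m
  rw [mulCoeff_eq_box _ S _ N hs hN m _ _ le_rfl le_rfl,
    mulCoeff_eq_box _ S _ N hM' hN m _ _ le_rfl le_rfl,
    mulCoeff_eq_box _ S _ N hK' hN m _ _ le_rfl le_rfl]
  simp only [← Finset.sum_add_distrib, ← term_add_left]
  rfl

protected theorem one_mul' (P : PsiDif) : 1 * P = P := by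
  ext1
  funext m
  change mulCoeff 1 P m = _
  rw [mulCoeff, finsum_eq_single _ (0, 0)]
  · change Ring.choose 0 0 • ((Pi.single 0 1 : ℤ → ℂ[T;T⁻¹]) 0 * _) = _
    simp
  · rintro ⟨i, n⟩ h
    change Ring.choose i n • ((Pi.single 0 1 : ℤ → ℂ[T;T⁻¹]) i * _) = _
    by_cases hi : i = 0
    · subst hi
      have : n ≠ 0 := fun hn => h (by rw [hn])
      rw [Ring.choose_zero_pos ℤ (Nat.pos_of_ne_zero this), zero_smul]
    · simp [Pi.single_eq_of_ne hi]

protected theorem mul_one' (P : PsiDif) : P * 1 = P := by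
  ext1
  funext m
  change mulCoeff P 1 m = _
  rw [mulCoeff, finsum_eq_single _ (m, 0)]
  · change Ring.choose m 0 • (_ * (Pi.single 0 1 : ℤ → ℂ[T;T⁻¹]) _) = _
    simp
  · rintro ⟨i, n⟩ h
    change Ring.choose i n • (_ * dx^[n] ((Pi.single 0 1 : ℤ → ℂ[T;T⁻¹]) (m - i + n))) = _
    by_cases hi : m - i + n = 0
    · rw [hi, Pi.single_eq_same]
      cases n with
      | zero => exact absurd (by simp at hi; rw [Prod.mk.injEq]; exact ⟨by omega, rfl⟩) h
      | succ n =>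
        rw [Function.iterate_succ_apply, Derivation.map_one_eq_zero, iterate_map_zero, mul_zero,
          smul_zero]
    · rw [Pi.single_eq_of_ne hi, iterate_map_zero, mul_zero, smul_zero]

instance : Ring PsiDif :=
  { (inferInstance : AddCommGroup PsiDif) with
    mul_assoc := PsiDif.mul_assoc'
    one_mul := PsiDif.one_mul'
    mul_one := PsiDif.mul_one'
    left_distrib := PsiDif.left_distrib'
    right_distrib := PsiDif.right_distrib'
    zero_mul := fun P => by
      have h := PsiDif.right_distrib' 0 0 P
      rw [add_zero] at h
      exact left_eq_add.1 h
    mul_zero := fun P => by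
      have h := PsiDif.left_distrib' P 0 0
      rw [add_zero] at h
      exact left_eq_add.1 h }

/-- The derivation `ad (ln ∂)`:
`a ∂ ^ i ↦ ∑_{n ≥ 1} (1 / n!) (∂_ξ ^ n ln ξ) a⁽ⁿ⁾ = ∑_{n ≥ 1} ((-1) ^ (n - 1) / n) a⁽ⁿ⁾ ∂ ^ (i - n)`
(in the sum below the summation index is `n - 1`). -/
def adLogD : PsiDif →+ PsiDif where
  toFun P :=
    ⟨fun m => ∑ᶠ n : ℕ, ((-1 : ℂ) ^ n / (n + 1)) • dx^[n + 1] (P.coeff (m + n + 1)), by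
      obtain ⟨N, hN⟩ := P.bounded
      refine ⟨N, fun m hm => finsum_eq_zero_of_forall_eq_zero fun n => ?_⟩
      rw [hN _ (by omega), iterate_map_zero, smul_zero]⟩
  map_zero' := by
    ext1
    funext m
    refine finsum_eq_zero_of_forall_eq_zero fun n => ?_
    change _ • dx^[n + 1] 0 = _
    rw [iterate_map_zero, smul_zero]
  map_add' P Q := by
    have key : ∀ (P : PsiDif) (m : ℤ), (Function.support fun n : ℕ =>
        ((-1 : ℂ) ^ n / (n + 1)) • dx^[n + 1] (P.coeff (m + n + 1))).Finite := by
      intro P m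
      obtain ⟨N, hN⟩ := P.bounded
      refine (Set.finite_Iic (N - m).toNat).subset fun n hn => ?_
      by_contra h
      simp only [Set.mem_Iic, not_le] at h
      exact hn (by simp only; rw [hN _ (by omega), iterate_map_zero, smul_zero])
    ext1
    funext m
    change _ = (∑ᶠ n : ℕ, ((-1 : ℂ) ^ n / (n + 1)) • dx^[n + 1] (P.coeff (m + n + 1))) +
      ∑ᶠ n : ℕ, ((-1 : ℂ) ^ n / (n + 1)) • dx^[n + 1] (Q.coeff (m + n + 1))
    rw [← finsum_add_distrib (key P m) (key Q m)]
    refine finsum_congr fun n => ?_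
    rw [← smul_add, ← iterate_map_add]
    rfl

/-- The derivation `ad (ln x)`:
`a ∂ ^ i ↦ [ln x, a ∂ ^ i] = - ∑_{n ≥ 1} (i choose n) a (ln x)⁽ⁿ⁾ ∂ ^ (i - n)`, where
`(ln x)⁽ⁿ⁾ = (-1) ^ (n - 1) (n - 1)! x ^ (-n)` (in the sum below the summation index is `n - 1`). -/
def adLogX : PsiDif →+ PsiDif where
  toFun P :=
    ⟨fun m => -∑ᶠ n : ℕ, (Ring.choose (m + n + 1) (n + 1) : ℤ) •
        (((-1 : ℂ) ^ n * (n.factorial : ℂ)) •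
          (P.coeff (m + n + 1) * LaurentPolynomial.T (-((n : ℤ) + 1)))), by
      obtain ⟨N, hN⟩ := P.bounded
      refine ⟨N, fun m hm => neg_eq_zero.2 (finsum_eq_zero_of_forall_eq_zero fun n => ?_)⟩
      rw [hN _ (by omega), zero_mul, smul_zero, smul_zero]⟩
  map_zero' := by
    ext1
    funext m
    refine neg_eq_zero.2 (finsum_eq_zero_of_forall_eq_zero fun n => ?_)
    change _ • (_ • ((0 : ℂ[T;T⁻¹]) * _)) = _
    rw [zero_mul, smul_zero, smul_zero]
  map_add' P Q := by
    have key : ∀ (P : PsiDif) (m : ℤ), (Function.support fun n : ℕ =>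
        (Ring.choose (m + n + 1) (n + 1) : ℤ) • (((-1 : ℂ) ^ n * (n.factorial : ℂ)) •
          (P.coeff (m + n + 1) * LaurentPolynomial.T (-((n : ℤ) + 1))))).Finite := by
      intro P m
      obtain ⟨N, hN⟩ := P.bounded
      refine (Set.finite_Iic (N - m).toNat).subset fun n hn => ?_
      by_contra h
      simp only [Set.mem_Iic, not_le] at h
      exact hn (by simp only; rw [hN _ (by omega), zero_mul, smul_zero, smul_zero])
    ext1
    funext m
    change _ = (-∑ᶠ n : ℕ, (Ring.choose (m + n + 1) (n + 1) : ℤ) •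
        (((-1 : ℂ) ^ n * (n.factorial : ℂ)) •
          (P.coeff (m + n + 1) * LaurentPolynomial.T (-((n : ℤ) + 1))))) +
      -∑ᶠ n : ℕ, (Ring.choose (m + n + 1) (n + 1) : ℤ) •
        (((-1 : ℂ) ^ n * (n.factorial : ℂ)) •
          (Q.coeff (m + n + 1) * LaurentPolynomial.T (-((n : ℤ) + 1))))
    rw [← neg_add, ← finsum_add_distrib (key P m) (key Q m)]
    refine congrArg Neg.neg (finsum_congr fun n => ?_)
    rw [← smul_add, ← smul_add, ← add_mul]
    rfl

/-- `Q = ∑_{n ≥ 1} ((n - 1)! / n) x ^ (-n) ∂ ^ (-n)`, with `[ad (ln ∂), ad (ln x)] = ad Q`. -/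
def Q : PsiDif where
  coeff m := if m < 0 then
    (((m.natAbs - 1).factorial : ℂ) / m.natAbs) • LaurentPolynomial.T m else 0
  bounded := ⟨0, fun i hi => if_neg (by omega)⟩

/-- The noncommutative residue: the coefficient at `x ^ (-1) ∂ ^ (-1)`. -/
def res (P : PsiDif) : ℂ := (P.coeff (-1)).coeff (-1)

/-- The differential operator `∂ = d/dx`. -/
def d : PsiDif := monomial 1 1

/-- The differential operator `x² ∂`. -/
def x2d : PsiDif := monomial 1 (LaurentPolynomial.T 2)

/-- The constant operator `c`. -/
def const (c : ℂ) : PsiDif := monomial 0 (LaurentPolynomial.C c)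

theorem const_zero : const 0 = 0 := by
  ext1
  simp only [const, monomial, map_zero, Pi.single_zero]
  rfl

end PsiDif

/-- Infinite matrices over `R` whose rows and columns are finite. They contain the matrices with
finitely many nonzero entries as well as the matrices `Id ⊗ r`. -/
@[ext]
structure InfMat (R : Type*) [Ring R] where
  entry : ℕ → ℕ → R
  row_finite : ∀ i, {j | entry i j ≠ 0}.Finite
  col_finite : ∀ j, {i | entry i j ≠ 0}.Finite

namespace InfMat

variable {R : Type*} [Ring R]

theorem entry_injective : Function.Injective (entry : InfMat R → ℕ → ℕ → R) :=
  fun _ _ h => InfMat.ext h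

/-- Apply a map with `f 0 = 0` to all entries. -/
def map {S : Type*} [Ring S] (f : R → S) (hf : f 0 = 0) (M : InfMat R) : InfMat S where
  entry i j := f (M.entry i j)
  row_finite i := (M.row_finite i).subset fun _ hj h => hj (by rw [h, hf])
  col_finite j := (M.col_finite j).subset fun _ hi h => hi (by rw [h, hf])

/-- The diagonal matrix `Id ⊗ r`. -/
def scalar (r : R) : InfMat R where
  entry i j := if i = j then r else 0
  row_finite i := (Set.finite_singleton i).subset fun j hj => by
    by_contra h
    exact hj (if_neg fun e => h e.symm)
  col_finite j := (Set.finite_singleton j).subset fun i hi => by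
    by_contra h
    exact hi (if_neg h)

/-- The composition of the diagonal sum with `τ`, for matrices with finitely many nonzero
entries `τ (Mᵢᵢ)`. -/
def trace (τ : R → ℂ) (M : InfMat R) : ℂ := ∑ᶠ i, τ (M.entry i i)

instance : Zero (InfMat R) := ⟨⟨0, fun _ => by simp, fun _ => by simp⟩⟩

instance : One (InfMat R) := ⟨scalar 1⟩

instance : Add (InfMat R) :=
  ⟨fun M N => ⟨M.entry + N.entry,
    fun i => ((M.row_finite i).union (N.row_finite i)).subset fun j hj => by
      by_contra h
      simp only [Set.mem_union, Set.mem_ofPred_eq, not_or, not_not] at h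
      exact hj (by simp [h.1, h.2]),
    fun j => ((M.col_finite j).union (N.col_finite j)).subset fun i hi => by
      by_contra h
      simp only [Set.mem_union, Set.mem_ofPred_eq, not_or, not_not] at h
      exact hi (by simp [h.1, h.2])⟩⟩

instance : Neg (InfMat R) := ⟨map (fun r => -r) neg_zero⟩

instance : AddCommGroup (InfMat R) where
  add_assoc M N P := entry_injective (add_assoc M.entry N.entry P.entry)
  zero_add M := entry_injective (zero_add M.entry)
  add_zero M := entry_injective (add_zero M.entry)
  add_comm M N := entry_injective (add_comm M.entry N.entry)
  neg_add_cancel M := entry_injective (neg_add_cancel M.entry)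
  nsmul := nsmulRec
  zsmul := zsmulRec

theorem exists_ne_zero_of_finsum {ι : Type*} {f : ι → R} (h : ∑ᶠ i, f i ≠ 0) : ∃ i, f i ≠ 0 := by
  by_contra! h'
  exact h (finsum_eq_zero_of_forall_eq_zero h')

/-- The matrix product. -/
instance : Mul (InfMat R) :=
  ⟨fun M N => ⟨fun i j => ∑ᶠ l, M.entry i l * N.entry l j,
    fun i => ((M.row_finite i).biUnion fun l _ => N.row_finite l).subset fun j hj => by
      obtain ⟨l, hl⟩ := exists_ne_zero_of_finsum hj
      exact Set.mem_biUnion (left_ne_zero_of_mul hl) (right_ne_zero_of_mul hl),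
    fun j => ((N.col_finite j).biUnion fun l _ => M.col_finite l).subset fun i hi => by
      obtain ⟨l, hl⟩ := exists_ne_zero_of_finsum hi
      exact Set.mem_biUnion (right_ne_zero_of_mul hl) (left_ne_zero_of_mul hl)⟩⟩

theorem mul_entry (M N : InfMat R) (i j : ℕ) :
    (M * N).entry i j = ∑ᶠ l, M.entry i l * N.entry l j := rfl

theorem mul_entry_eq_row (M N : InfMat R) (i j : ℕ) (s : Finset ℕ)
    (hs : ∀ l, M.entry i l ≠ 0 → l ∈ s) :
    (M * N).entry i j = ∑ l ∈ s, M.entry i l * N.entry l j :=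
  finsum_eq_sum_of_support_subset _ fun l hl => hs l (left_ne_zero_of_mul hl)

theorem mul_entry_eq_col (M N : InfMat R) (i j : ℕ) (s : Finset ℕ)
    (hs : ∀ l, N.entry l j ≠ 0 → l ∈ s) :
    (M * N).entry i j = ∑ l ∈ s, M.entry i l * N.entry l j :=
  finsum_eq_sum_of_support_subset _ fun l hl => hs l (right_ne_zero_of_mul hl)

instance : Ring (InfMat R) :=
  { (inferInstance : AddCommGroup (InfMat R)) with
    mul_assoc := fun M N P => by
      ext i j
      have hs : ∀ l, M.entry i l ≠ 0 → l ∈ (M.row_finite i).toFinset := fun l hl => by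
        simpa using hl
      have ht : ∀ l, P.entry l j ≠ 0 → l ∈ (P.col_finite j).toFinset := fun l hl => by
        simpa using hl
      rw [mul_entry_eq_col (M * N) P i j _ ht, mul_entry_eq_row M (N * P) i j _ hs]
      simp only [mul_entry_eq_row M N i _ _ hs, mul_entry_eq_col N P _ j _ ht, Finset.sum_mul,
        Finset.mul_sum, mul_assoc]
      exact Finset.sum_comm
    one_mul := fun M => by
      ext i j
      rw [mul_entry_eq_row 1 M i j {i}]
      · change ∑ l ∈ {i}, (if i = l then (1 : R) else 0) * M.entry l j = _
        simp
      · intro l hl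
        by_contra h
        exact hl (if_neg fun e => h (by simp [e]))
    mul_one := fun M => by
      ext i j
      rw [mul_entry_eq_col M 1 i j {j}]
      · change ∑ l ∈ {j}, M.entry i l * (if l = j then (1 : R) else 0) = _
        simp
      · intro l hl
        by_contra h
        exact hl (if_neg fun e => h (by simp [e]))
    left_distrib := fun M N P => by
      ext i j
      have hs : ∀ l, M.entry i l ≠ 0 → l ∈ (M.row_finite i).toFinset := fun l hl => by
        simpa using hl
      change _ = (M * N).entry i j + (M * P).entry i j
      rw [mul_entry_eq_row _ _ i j _ hs, mul_entry_eq_row _ _ i j _ hs,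
        mul_entry_eq_row _ _ i j _ hs, ← Finset.sum_add_distrib]
      exact Finset.sum_congr rfl fun l _ => mul_add _ _ _
    right_distrib := fun M N P => by
      ext i j
      have hs : ∀ l, P.entry l j ≠ 0 → l ∈ (P.col_finite j).toFinset := fun l hl => by
        simpa using hl
      change _ = (M * P).entry i j + (N * P).entry i j
      rw [mul_entry_eq_col _ _ i j _ hs, mul_entry_eq_col _ _ i j _ hs,
        mul_entry_eq_col _ _ i j _ hs, ← Finset.sum_add_distrib]
      exact Finset.sum_congr rfl fun l _ => add_mul _ _ _
    zero_mul := fun M => by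
      ext i j
      exact finsum_eq_zero_of_forall_eq_zero fun l => zero_mul _
    mul_zero := fun M => by
      ext i j
      exact finsum_eq_zero_of_forall_eq_zero fun l => mul_zero _ }

instance : SMul ℂ (InfMat ℂ) := ⟨fun c => map (fun r => c * r) (mul_zero c)⟩

instance : Module ℂ (InfMat ℂ) where
  one_smul M := entry_injective (one_smul ℂ M.entry)
  mul_smul a b M := entry_injective (mul_smul a b M.entry)
  smul_zero a := entry_injective (smul_zero (A := ℕ → ℕ → ℂ) a)
  smul_add a M N := entry_injective (smul_add a M.entry N.entry)
  add_smul a b M := entry_injective (add_smul a b M.entry)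
  zero_smul M := entry_injective (zero_smul ℂ M.entry)

instance : Algebra ℂ (InfMat ℂ) :=
  Algebra.ofModule
    (fun a M N => by
      ext i j
      have hs : ∀ l, M.entry i l ≠ 0 → l ∈ (M.row_finite i).toFinset := fun l hl => by
        simpa using hl
      change _ = a * (M * N).entry i j
      rw [mul_entry_eq_row (a • M) N i j _ fun l hl => hs l (right_ne_zero_of_mul hl),
        mul_entry_eq_row M N i j _ hs, Finset.mul_sum]
      exact Finset.sum_congr rfl fun l _ => mul_assoc _ _ _)
    (fun a M N => by
      ext i j
      have hs : ∀ l, M.entry i l ≠ 0 → l ∈ (M.row_finite i).toFinset := fun l hl => by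
        simpa using hl
      change _ = a * (M * N).entry i j
      rw [mul_entry_eq_row M (a • N) i j _ hs, mul_entry_eq_row M N i j _ hs, Finset.mul_sum]
      exact Finset.sum_congr rfl fun l _ => mul_left_comm _ _ _)

instance : LieRing (InfMat ℂ) := LieRing.ofAssociativeRing

/-- All but finitely many entries vanish. -/
def IsFin (M : InfMat R) : Prop := {p : ℕ × ℕ | M.entry p.1 p.2 ≠ 0}.Finite

theorem IsFin.add {M N : InfMat R} (hM : M.IsFin) (hN : N.IsFin) : (M + N).IsFin :=
  (hM.union hN).subset fun p hp => by
    by_contra h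
    simp only [Set.mem_union, Set.mem_ofPred_eq, not_or, not_not] at h
    exact hp (by change M.entry p.1 p.2 + N.entry p.1 p.2 = 0; rw [h.1, h.2, add_zero])

theorem IsFin.map {S : Type*} [Ring S] {M : InfMat R} (hM : M.IsFin) (f : R → S) (hf : f 0 = 0) :
    (M.map f hf).IsFin :=
  hM.subset fun p hp h => hp (by change f (M.entry p.1 p.2) = 0; rw [h, hf])

theorem IsFin.mul {M N : InfMat R} (hM : M.IsFin) (hN : N.IsFin) : (M * N).IsFin :=
  ((hM.image Prod.fst).prod (hN.image Prod.snd)).subset fun p hp => by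
    obtain ⟨l, hl⟩ := exists_ne_zero_of_finsum hp
    exact ⟨⟨(p.1, l), left_ne_zero_of_mul hl, rfl⟩, ⟨(l, p.2), right_ne_zero_of_mul hl, rfl⟩⟩

end InfMat

/-- The Lie algebra of infinite complex matrices with finitely many nonzero entries, with the
bracket `[A, B] = A B - B A`. -/
def glFin : LieSubalgebra ℂ (InfMat ℂ) where
  carrier := {M | M.IsFin}
  zero_mem' := by
    change Set.Finite {p : ℕ × ℕ | (0 : ℂ) ≠ 0}
    simp
  add_mem' hM hN := hM.add hN
  smul_mem' c _ hM := hM.map _ (mul_zero c)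
  lie_mem' {M N} hM hN := by
    change (M * N - N * M).IsFin
    rw [sub_eq_add_neg]
    exact (hM.mul hN).add ((hN.mul hM).map _ neg_zero)

/-- The matrix unit `E₁₁` (the first row and column have index `0` here). -/
def glFin.E11 : glFin :=
  ⟨⟨fun i j => if i = 0 ∧ j = 0 then 1 else 0,
    fun _ => (Set.finite_singleton 0).subset fun j hj => by
      by_contra h
      exact hj (if_neg fun e => h e.2),
    fun _ => (Set.finite_singleton 0).subset fun i hi => by
      by_contra h
      exact hi (if_neg fun e => h e.1)⟩,
    (Set.finite_singleton (0, 0)).subset fun p hp => by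
      by_contra h
      exact hp (if_neg fun e => h (Prod.ext e.1 e.2))⟩

/-- The alternation `∑_σ sgn σ · f (A_{σ 1}, …, A_{σ n})`, without normalizing factor. -/
def alternate {V W : Type*} [AddCommGroup W] {n : ℕ} (f : (Fin n → V) → W) (A : Fin n → V) : W :=
  ∑ σ : Equiv.Perm (Fin n), (Equiv.Perm.sign σ : ℤ) • f (A ∘ σ)

section Lifting

variable {𝔄 : Type*} [Ring 𝔄]

/-- The product `D A₁ · A₂ · … · A_{2s-1} · D' A_{2s} · A_{2s+1} · … · A_n`. -/
def liftingWord (D D' : 𝔄 → 𝔄) (s : ℕ) {n : ℕ} (A : Fin n → 𝔄) : 𝔄 :=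
  (List.ofFn fun j : Fin n =>
    if j.val = 0 then D (A j) else if j.val + 1 = 2 * s then D' (A j) else A j).prod

/-- The coefficient of the word with `D₂` in position `2s` in the lifting formula for
`Ψ_{2k+1}`: it is `1` if `2s ≤ k + 1`, it is `1/2` if `2s = k + 2` (which happens for even `k`
only), and there are no further terms. -/
def liftingWeight (k s : ℕ) : ℂ :=
  if 2 * s ≤ k + 1 then 1 else if 2 * s = k + 2 then 1 / 2 else 0

/-- The lifting formula for `Ψ_{2k+1}` (`k ≥ 1`) on an algebra with a trace `Tr`, and derivations
`D₁`, `D₂` with `[D₁, D₂] = ad Q`: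
`Alt_A Tr (Q A₁ ⋯ A_{2k+1}) +
  Alt_{A,D} Tr (D₁A₁ D₂A₂ A₃ ⋯ A_{2k+1} + D₁A₁ A₂ A₃ D₂A₄ A₅ ⋯ A_{2k+1} + ⋯)`. -/
def lifting (Tr : 𝔄 → ℂ) (D₁ D₂ : 𝔄 → 𝔄) (Q : 𝔄) (k : ℕ) (A : Fin (2 * k + 1) → 𝔄) : ℂ :=
  alternate (fun B => Tr (Q * (List.ofFn B).prod)) A +
    ∑ s ∈ Finset.Icc 1 k, liftingWeight k s *
      alternate (fun B => Tr (liftingWord D₁ D₂ s B) - Tr (liftingWord D₂ D₁ s B)) A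

end Lifting

/-- The lifting cochain `Ψ_{2k+1}` for matrices over pseudo-differential operators on the circle:
`Tr` is the composition of the matrix trace with the residue, `D₁ = ad (ln ∂)`, `D₂ = ad (ln x)`
act entrywise, and `Q` stands for `Id ⊗ Q`. The formula makes sense as soon as one of the arguments
has finitely many nonzero entries. -/
def Psi (k : ℕ) : (Fin (2 * k + 1) → InfMat PsiDif) → ℂ :=
  lifting (InfMat.trace PsiDif.res)
    (InfMat.map PsiDif.adLogD (map_zero _)) (InfMat.map PsiDif.adLogX (map_zero _))
    (InfMat.scalar PsiDif.Q) k

/-- The inclusion `A ↦ A ⊗ 1` of matrices of numbers into matrices of operators. -/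
def tensorOne (A : glFin) : InfMat PsiDif := (A : InfMat ℂ).map PsiDif.const PsiDif.const_zero

/-- `Ψ_{2k+1} (Id ⊗ ∂, Id ⊗ x²∂, A₁ ⊗ 1, …, A_{2k-1} ⊗ 1)`. -/
def PsiContracted (k : ℕ) (A : Fin (2 * k - 1) → glFin) : ℂ :=
  Psi k fun j =>
    if j.val = 0 then InfMat.scalar PsiDif.d
    else if h : 2 ≤ j.val then tensorOne (A ⟨j.val - 2, by omega⟩)
    else InfMat.scalar PsiDif.x2d

section Chains

variable {L : Type*} [LieRing L] [LieAlgebra ℂ L]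

/-- The Chevalley–Eilenberg boundary of `x₁ ∧ … ∧ x_p`:
`∑_{a < b} (-1) ^ (a + b) [x_a, x_b] ∧ x₁ ∧ … x̂_a … x̂_b … ∧ x_p`. -/
def boundary {p : ℕ} (x : Fin p → L) : ExteriorAlgebra ℂ L :=
  ∑ a : Fin p, ∑ b ∈ Finset.Ioi a, (-1 : ℂ) ^ (a.val + b.val) •
    (ExteriorAlgebra.ι ℂ ⁅x a, x b⁆ *
      (((List.finRange p).filter fun l => l ≠ a ∧ l ≠ b).map
        fun l => ExteriorAlgebra.ι ℂ (x l)).prod)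

/-- The chain `∑ᵢ x₁⁽ⁱ⁾ ∧ … ∧ x_p⁽ⁱ⁾` with trivial coefficients is a cycle. -/
def IsCycle {m p : ℕ} (x : Fin m → Fin p → L) : Prop := ∑ i, boundary (x i) = 0

end Chains

end

/-
Expand the alternations in `Ψ_{2k+1}` along the positions of the arguments `∂` and `x²∂`. All other
arguments are `A ⊗ 1`, killed by `D₁` and `D₂`, so each pair of positions contributes a sign, a
residue involving only `∂` and `x²∂`, and the alternated trace of the matrices `A`. As `D₁ ∂ = 0`,
`res (Q [∂, x²∂]) = -1`, and the products of `D₁ (x²∂)` and `D₂ ∂` in either order have residue `1`,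
counting the positions gives the coefficient `-k - (k + 1) = -(2k + 1)`.

The cycle on which the alternated trace does not vanish is the sum of
`E_{v₀v₁} ∧ E_{v₁v₂} ∧ … ∧ E_{v_{2k-2}v₀}` over all closed paths `v` in `2k - 1` vertices. With `X`
the matrix over the exterior algebra whose entries are the generators `Eᵢⱼ`, this chain is
`tr X^{2k-1}`; its boundary is a combination of `tr X^{2k-2}` and of `∑ ± tr X^l · tr X^m` with
`l + m = 2k - 2`, which vanish because the entries of `X` anticommute (for `k = 1` they cancel).
The value on it is a positive multiple of a sum of squares, in which the closed path through
`2k - 1` distinct vertices has a nonzero term: cyclic rotations of an odd number of factors are even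
permutations.
-/

noncomputable section

open PsiDif InfMat

namespace PsiDif

open LaurentPolynomial (T C)

theorem coeff_smul (c : ℂ) (P : PsiDif) (m : ℤ) : (c • P).coeff m = c • P.coeff m := rfl

theorem coeff_mul (P S : PsiDif) (m : ℤ) : (P * S).coeff m = mulCoeff P S m := rfl

theorem coeff_sum {ι : Type*} (s : Finset ι) (P : ι → PsiDif) (m : ℤ) :
    (∑ i ∈ s, P i).coeff m = ∑ i ∈ s, (P i).coeff m :=
  map_sum ((Pi.evalAddMonoidHom (fun _ : ℤ => ℂ[T;T⁻¹]) m).comp coeffHom) P s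

theorem coeff_monomial (n m : ℤ) (a : ℂ[T;T⁻¹]) :
    (monomial n a).coeff m = if m = n then a else 0 := Pi.single_apply n a m

theorem monomial_neg (n : ℤ) (a : ℂ[T;T⁻¹]) : monomial n (-a) = -monomial n a :=
  coeff_injective (Pi.single_neg (f := fun _ => ℂ[T;T⁻¹]) n a)

theorem monomial_sub (n : ℤ) (a b : ℂ[T;T⁻¹]) :
    monomial n (a - b) = monomial n a - monomial n b :=
  coeff_injective (Pi.single_sub (f := fun _ => ℂ[T;T⁻¹]) n a b)

theorem dx_T (n : ℤ) : dx (T n : ℂ[T;T⁻¹]) = (n : ℂ) • T (n - 1) := by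
  change dxLin (AddMonoidAlgebra.single n 1) = _
  rw [dxLin_single, LaurentPolynomial.T, AddMonoidAlgebra.smul_single, one_mul, smul_eq_mul,
    mul_one]

theorem dx_iterate_smul (n : ℕ) (c : ℂ) (a : ℂ[T;T⁻¹]) : dx^[n] (c • a) = c • dx^[n] a :=
  Function.Commute.iterate_left (f := dx) (g := (c • ·)) (fun a => dx.map_smul c a) n a

theorem dx_iterate_eq_zero_of_le {m n : ℕ} {a : ℂ[T;T⁻¹]} (ha : dx^[m] a = 0) (hmn : m ≤ n) :
    dx^[n] a = 0 := by
  rw [← Nat.sub_add_cancel hmn, Function.iterate_add_apply, ha, iterate_map_zero]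

theorem coeff_monomial_mul_monomial (i j m : ℤ) (a b : ℂ[T;T⁻¹]) :
    (monomial i a * monomial j b).coeff m = term i j m a b := by
  rw [coeff_mul, mulCoeff_eq_sum _ _ _ {i} {j}]
  · simp only [Finset.sum_singleton, coeff_monomial, if_true]
  · intro i' j' _ hi hj
    rw [coeff_monomial] at hi hj
    simp only [Finset.mem_singleton]
    exact ⟨by_contra fun h => hi (if_neg h), by_contra fun h => hj (if_neg h)⟩

theorem monomial_natCast_mul_monomial (k : ℕ) (j : ℤ) (a b : ℂ[T;T⁻¹]) :
    monomial k a * monomial j b =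
      ∑ n ∈ Finset.range (k + 1), monomial (k + j - n) (k.choose n • (a * dx^[n] b)) := by
  ext1
  funext m
  rw [coeff_monomial_mul_monomial, term, coeff_sum]
  simp only [coeff_monomial]
  split_ifs with hm
  · obtain ⟨n, rfl⟩ : ∃ n : ℕ, m = k + j - n := ⟨(k + j - m).toNat, by omega⟩
    simp only [sub_sub_cancel, Int.toNat_natCast, Ring.choose_natCast, natCast_zsmul, sub_right_inj,
      Nat.cast_inj, Finset.sum_ite_eq, Finset.mem_range]
    split_ifs with hn
    · rfl
    · rw [Nat.choose_eq_zero_of_lt (by omega), zero_smul]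
  · exact (Finset.sum_eq_zero fun n _ => if_neg (by omega)).symm

theorem commutator_monomial_one_monomial_one (a b : ℂ[T;T⁻¹]) :
    monomial 1 a * monomial 1 b - monomial 1 b * monomial 1 a =
      monomial 1 (a * dx b - b * dx a) := by
  have h (a b : ℂ[T;T⁻¹]) :
      monomial 1 a * monomial 1 b = monomial 2 (a * b) + monomial 1 (a * dx b) := by
    simpa [Finset.sum_range_succ] using monomial_natCast_mul_monomial 1 1 a b
  rw [h, h, mul_comm b a, add_sub_add_left_eq_sub, monomial_sub]

instance : Algebra ℂ PsiDif :=
  Algebra.ofModule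
    (fun c P S => by
      ext1
      funext m
      simp only [coeff_mul, coeff_smul, mulCoeff, smul_finsum, smul_mul_assoc]
      exact finsum_congr fun p => smul_comm ..)
    (fun c P S => by
      ext1
      funext m
      simp only [coeff_mul, coeff_smul, mulCoeff, smul_finsum, dx_iterate_smul, mul_smul_comm]
      exact finsum_congr fun p => smul_comm ..)

theorem const_eq_smul_one (c : ℂ) : const c = c • 1 := by
  ext1
  funext m
  change (monomial 0 (C c)).coeff m = c • (monomial 0 1).coeff m
  simp only [coeff_monomial, smul_ite, smul_zero, LaurentPolynomial.smul_eq_C_mul, mul_one]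

/-- The noncommutative residue as a linear form. -/
def resLin : PsiDif →ₗ[ℂ] ℂ where
  toFun := res
  map_add' _ _ := rfl
  map_smul' _ _ := rfl

theorem resLin_apply (P : PsiDif) : resLin P = res P := rfl

/-- `ad (ln ∂)` as a complex linear map. -/
def adLogDLin : PsiDif →ₗ[ℂ] PsiDif where
  toFun := adLogD
  map_add' := map_add adLogD
  map_smul' c P := by
    ext1
    funext m
    change ∑ᶠ n : ℕ, _ • dx^[n + 1] (c • P.coeff (m + n + 1)) = c • ∑ᶠ n : ℕ, _
    rw [smul_finsum]
    exact finsum_congr fun n => by rw [dx_iterate_smul, smul_comm]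

/-- `ad (ln x)` as a complex linear map. -/
def adLogXLin : PsiDif →ₗ[ℂ] PsiDif where
  toFun := adLogX
  map_add' := map_add adLogX
  map_smul' c P := by
    ext1
    funext m
    change -∑ᶠ n : ℕ, (_ : ℤ) • (_ : ℂ) • ((c • P.coeff (m + n + 1)) * _) = c • -∑ᶠ n : ℕ, _
    rw [smul_neg, smul_finsum]
    refine congrArg Neg.neg (finsum_congr fun n => ?_)
    rw [smul_mul_assoc, smul_comm c (Ring.choose _ _), smul_comm c (_ * _ : ℂ)]

theorem adLogD_monomial (i : ℤ) {a : ℂ[T;T⁻¹]} {N : ℕ} (ha : dx^[N + 1] a = 0) :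
    adLogD (monomial i a) = ∑ n ∈ Finset.range N,
      monomial (i - (n + 1)) (((-1 : ℂ) ^ n / (n + 1)) • dx^[n + 1] a) := by
  ext1
  funext m
  change ∑ᶠ n : ℕ, ((-1 : ℂ) ^ n / (n + 1)) • dx^[n + 1] ((monomial i a).coeff (m + n + 1)) = _
  rw [finsum_eq_sum_of_support_subset (s := Finset.range N), coeff_sum]
  · refine Finset.sum_congr rfl fun n _ => ?_
    rw [coeff_monomial, coeff_monomial]
    by_cases h : m = i - (n + 1)
    · rw [if_pos h, if_pos (by omega)]
    · rw [if_neg h, if_neg (by omega), iterate_map_zero, smul_zero]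
  · intro n hn
    by_contra h
    have hNn : N + 1 ≤ n + 1 := by simpa using h
    refine hn ?_
    simp only [coeff_monomial]
    split_ifs
    · rw [dx_iterate_eq_zero_of_le ha hNn, smul_zero]
    · rw [iterate_map_zero, smul_zero]

theorem adLogX_monomial_natCast (k : ℕ) (a : ℂ[T;T⁻¹]) :
    adLogX (monomial k a) = -∑ n ∈ Finset.range k, monomial (k - (n + 1))
      (k.choose (n + 1) • ((-1 : ℂ) ^ n * n.factorial) • (a * T (-(n + 1)))) := by
  ext1
  funext m
  change -∑ᶠ n : ℕ, (Ring.choose (m + n + 1) (n + 1) : ℤ) • (((-1 : ℂ) ^ n * n.factorial) •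
      ((monomial k a).coeff (m + n + 1) * T (-((n : ℤ) + 1)))) = -(∑ n ∈ _, _ : PsiDif).coeff m
  rw [finsum_eq_sum_of_support_subset (s := Finset.range k), coeff_sum]
  · refine congrArg Neg.neg (Finset.sum_congr rfl fun n _ => ?_)
    rw [coeff_monomial, coeff_monomial]
    by_cases h : m = k - (n + 1)
    · rw [if_pos h, if_pos (by omega), show m + n + 1 = k by omega, Ring.choose_natCast,
        natCast_zsmul]
    · rw [if_neg h, if_neg (by omega), zero_mul, smul_zero, smul_zero]
  · intro n hn
    by_contra h
    have hkn : k < n + 1 := Nat.lt_succ_of_le (by simpa using h)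
    refine hn ?_
    simp only [coeff_monomial]
    split_ifs with hm
    · rw [hm, Ring.choose_natCast, Nat.choose_eq_zero_of_lt hkn, Nat.cast_zero, zero_smul]
    · rw [zero_mul, smul_zero, smul_zero]

theorem adLogD_one : adLogD 1 = 0 :=
  adLogD_monomial 0 (N := 0) dx.map_one_eq_zero

theorem adLogX_one : adLogX 1 = 0 :=
  (adLogX_monomial_natCast 0 1).trans (by rw [Finset.sum_range_zero, neg_zero])

theorem adLogD_d : adLogD d = 0 :=
  adLogD_monomial 1 (N := 0) dx.map_one_eq_zero

theorem adLogX_d : adLogX d = -monomial 0 (T (-1)) :=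
  (adLogX_monomial_natCast 1 1).trans (by simp)

theorem adLogD_x2d : adLogD x2d = monomial 0 ((2 : ℂ) • T 1) - monomial (-1) 1 := by
  have h3 : dx^[3] (T 2 : ℂ[T;T⁻¹]) = 0 := by simp [dx_T]
  have h2 : dx^[2] (T 2 : ℂ[T;T⁻¹]) = (2 : ℂ) • 1 := by simp [dx_T]
  rw [x2d, adLogD_monomial 1 h3, Finset.sum_range_succ, Finset.sum_range_one, h2, smul_smul,
    show ((-1 : ℂ) ^ 1 / ((1 : ℕ) + 1) * 2) = -1 by norm_num, neg_one_smul, monomial_neg]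
  simp [dx_T, sub_eq_add_neg]

theorem res_monomial_mul_monomial (i j : ℤ) (a b : ℂ[T;T⁻¹]) :
    res (monomial i a * monomial j b) = (term i j (-1) a b).coeff (-1) := by
  rw [res, coeff_monomial_mul_monomial]

theorem res_adLogD_x2d_mul_adLogX_d : res (adLogD x2d * adLogX d) = 1 := by
  rw [adLogD_x2d, adLogX_d, ← monomial_neg, sub_mul, ← resLin_apply, map_sub]
  simp [resLin_apply, res_monomial_mul_monomial, term]

theorem res_adLogX_d_mul_adLogD_x2d : res (adLogX d * adLogD x2d) = 1 := by
  rw [adLogD_x2d, adLogX_d, ← monomial_neg, mul_sub, ← resLin_apply, map_sub]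
  simp [resLin_apply, res_monomial_mul_monomial, term]

theorem d_mul_x2d_sub_x2d_mul_d : d * x2d - x2d * d = monomial 1 ((2 : ℂ) • T 1) := by
  rw [d, x2d, commutator_monomial_one_monomial_one]
  simp [dx_T]

theorem res_Q_mul_commutator : res (Q * (d * x2d - x2d * d)) = -1 := by
  have hQ₂ : term (-2) 1 (-1) (Q.coeff (-2)) ((2 : ℂ) • T 1) = T (-1) := by
    have h : (T (-2) * T 1 : ℂ[T;T⁻¹]) = T (-1) := (LaurentPolynomial.T_add _ _).symm
    simp [term, Q, h]
  have hQ₁ : term (-1) 1 (-1) (Q.coeff (-1)) ((2 : ℂ) • T 1) = (-2 : ℂ) • T (-1) := by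
    have h : (Ring.choose (-1 : ℤ) 1 : ℤ) = -1 := Ring.choose_one_right _
    simp [term, Q, dx_T, h]
  rw [d_mul_x2d_sub_x2d_mul_d, res, coeff_mul, mulCoeff_eq_sum _ _ _ {-2, -1} {1},
    Finset.sum_pair (by decide), Finset.sum_singleton, Finset.sum_singleton, coeff_monomial,
    if_pos rfl, hQ₂, hQ₁, show (T (-1) + (-2 : ℂ) • T (-1) : ℂ[T;T⁻¹]) = -T (-1) by module]
  · simp
  · intro i j hij hi hj
    rw [coeff_monomial] at hj
    have hj' : j = 1 := by_contra fun h => hj (if_neg h)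
    have hi' : i < 0 := by_contra fun h => hi (if_neg h)
    simp only [Finset.mem_insert, Finset.mem_singleton]
    omega

end PsiDif

section Alternate

variable {V W : Type*} [AddCommGroup W] {n : ℕ}

theorem map_alternate {W' : Type*} [AddCommGroup W'] (φ : W →+ W') (f : (Fin n → V) → W)
    (A : Fin n → V) : φ (alternate f A) = alternate (fun B => φ (f B)) A := by
  simp only [alternate, map_sum, map_zsmul]

theorem bijective_decomposeFin_mul_cycleRange (n : ℕ) :
    Function.Bijective fun x : Fin (n + 1) × Equiv.Perm (Fin n) =>
      Equiv.Perm.decomposeFin.symm (0, x.2) * x.1.cycleRange := by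
  have hzero (x : Fin (n + 1) × Equiv.Perm (Fin n)) :
      (Equiv.Perm.decomposeFin.symm (0, x.2) * x.1.cycleRange) x.1 = 0 := by
    rw [Equiv.Perm.mul_apply, Fin.cycleRange_self, Equiv.Perm.decomposeFin_symm_apply_zero]
  rw [Fintype.bijective_iff_injective_and_card]
  constructor
  · rintro ⟨p, τ⟩ ⟨q, ρ⟩ h
    obtain rfl : p = q := by
      refine Equiv.injective (Equiv.Perm.decomposeFin.symm (0, ρ) * q.cycleRange) ?_
      exact ((congrArg (· p) h).symm.trans (hzero (p, τ))).trans (hzero (q, ρ)).symm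
    simpa using mul_right_cancel h
  · rw [Fintype.card_prod, Fintype.card_perm, Fintype.card_perm, Fintype.card_fin,
      Fintype.card_fin, Nat.factorial_succ]

theorem cons_comp_decomposeFin_mul_cycleRange (a : V) (v : Fin n → V) (p : Fin (n + 1))
    (τ : Equiv.Perm (Fin n)) :
    (Fin.cons a v : Fin (n + 1) → V) ∘ (Equiv.Perm.decomposeFin.symm (0, τ) * p.cycleRange) =
      p.insertNth a (v ∘ τ) := by
  rw [← Fin.cons_comp_cycleRange, Equiv.Perm.coe_mul, ← Function.comp_assoc]
  congr 1
  funext j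
  cases j using Fin.cases <;> simp

theorem alternate_cons (f : (Fin (n + 1) → V) → W) (a : V) (v : Fin n → V) :
    alternate f (Fin.cons a v : Fin (n + 1) → V) =
      ∑ p : Fin (n + 1), (-1 : ℤ) ^ p.val • alternate (fun w => f (p.insertNth a w)) v := by
  rw [alternate, ← (bijective_decomposeFin_mul_cycleRange n).sum_comp, Fintype.sum_prod_type]
  simp only [cons_comp_decomposeFin_mul_cycleRange, alternate, Finset.smul_sum, smul_smul,
    Equiv.Perm.sign_mul, Fin.sign_cycleRange, Equiv.Perm.decomposeFin.symm_sign, if_true, one_mul,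
    mul_comm, Units.val_mul, Units.val_pow_eq_pow_val, Units.val_neg, Units.val_one]

end Alternate

section PairWord

variable {M : Type*} [Monoid M] {n : ℕ}

theorem prod_ofFn_eq_single {v : Fin n → M} (i : Fin n) (hv : ∀ l, l ≠ i → v l = 1) :
    (List.ofFn v).prod = v i := by
  induction n with
  | zero => exact i.elim0
  | succ n ih =>
    rw [List.ofFn_succ, List.prod_cons]
    cases i using Fin.cases with
    | zero =>
      rw [List.prod_eq_one, mul_one]
      rintro x hx
      obtain ⟨l, rfl⟩ := List.mem_ofFn.1 hx
      exact hv _ l.succ_ne_zero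
    | succ i =>
      rw [hv 0 i.succ_ne_zero.symm, one_mul]
      exact ih i fun l hl => hv l.succ (by simpa using hl)

theorem prod_ofFn_eq_mul {v : Fin n → M} {i j : Fin n} (hij : i < j)
    (hv : ∀ l, l ≠ i → l ≠ j → v l = 1) : (List.ofFn v).prod = v i * v j := by
  induction n with
  | zero => exact i.elim0
  | succ n ih =>
    rw [List.ofFn_succ, List.prod_cons]
    obtain ⟨j, rfl⟩ := Fin.exists_succ_eq.2 (Fin.ne_zero_of_lt hij)
    cases i using Fin.cases with
    | zero => rw [prod_ofFn_eq_single j fun l hl => hv _ l.succ_ne_zero (by simpa using hl)]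
    | succ i =>
      rw [hv 0 i.succ_ne_zero.symm j.succ_ne_zero.symm, one_mul]
      exact ih (by simpa using hij) fun l hi hj => hv l.succ (by simpa using hi) (by simpa using hj)

/-- The word with letters `a` and `b` at the positions `i` and `j`, and `1` elsewhere. -/
def pairWord (i j : Fin n) (a b : M) : Fin n → M := Function.update (Function.update 1 i a) j b

theorem pairWord_left {i j : Fin n} (hij : i ≠ j) (a b : M) : pairWord i j a b i = a := by
  rw [pairWord, Function.update_of_ne hij, Function.update_self]

theorem pairWord_right (i j : Fin n) (a b : M) : pairWord i j a b j = b :=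
  Function.update_self ..

theorem pairWord_of_ne {i j l : Fin n} (hi : l ≠ i) (hj : l ≠ j) (a b : M) :
    pairWord i j a b l = 1 := by
  rw [pairWord, Function.update_of_ne hj, Function.update_of_ne hi, Pi.one_apply]

theorem pairWord_comm {i j : Fin n} (hij : i ≠ j) (a b : M) :
    pairWord i j a b = pairWord j i b a :=
  Function.update_comm hij ..

theorem prod_ofFn_pairWord {i j : Fin n} (hij : i < j) (a b : M) :
    (List.ofFn (pairWord i j a b)).prod = a * b := by
  rw [prod_ofFn_eq_mul hij fun l hi hj => pairWord_of_ne hi hj a b, pairWord_left hij.ne,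
    pairWord_right]

theorem insertNth_insertNth_one (p : Fin (n + 2)) (q : Fin (n + 1)) (a b : M) :
    (p.insertNth a (q.insertNth b 1 : Fin (n + 1) → M) : Fin (n + 2) → M) =
      pairWord p (p.succAbove q) a b := by
  funext l
  induction l using p.succAboveCases with
  | x => rw [Fin.insertNth_apply_same, pairWord_left (p.succAbove_ne q).symm]
  | p l =>
    rw [Fin.insertNth_apply_succAbove]
    induction l using q.succAboveCases with
    | x => rw [Fin.insertNth_apply_same, pairWord_right]
    | p l =>
      rw [Fin.insertNth_apply_succAbove, pairWord_of_ne (p.succAbove_ne _)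
        (by simp), Pi.one_apply]

theorem prod_ofFn_insertNth_one (p : Fin (n + 1)) (w : Fin n → M) :
    (List.ofFn (p.insertNth (1 : M) w : Fin (n + 1) → M)).prod = (List.ofFn w).prod := by
  induction n with
  | zero => simp [Fin.fin_one_eq_zero p]
  | succ n ih =>
    cases p using Fin.cases with
    | zero => simp [Fin.insertNth_zero', List.ofFn_succ]
    | succ p =>
      rw [← Fin.cons_self_tail w, Fin.insertNth_succ_cons, List.ofFn_cons, List.ofFn_cons,
        List.prod_cons, List.prod_cons, ih]

end PairWord

section PairSum

variable {n : ℕ}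

theorem sum_neg_one_pow_mul_succAbove (p : Fin (n + 1)) (h : Fin (n + 1) → ℂ) :
    ∑ q : Fin n, (-1) ^ q.val * h (p.succAbove q) =
      ∑ j ∈ Finset.Iio p, (-1) ^ j.val * h j - ∑ j ∈ Finset.Ioi p, (-1) ^ j.val * h j := by
  let g (j : Fin (n + 1)) : ℂ := (if j < p then (-1) ^ j.val * h j else 0) -
    if p < j then (-1) ^ j.val * h j else 0
  have hg (q : Fin n) : (-1) ^ q.val * h (p.succAbove q) = g (p.succAbove q) := by
    rcases lt_or_ge q.castSucc p with hq | hq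
    · simp [g, Fin.succAbove_of_castSucc_lt p q hq, hq, hq.not_gt]
    · have hq' : p < q.succ := Fin.le_castSucc_iff.1 hq
      simp [g, Fin.succAbove_of_le_castSucc p q hq, hq', hq'.not_gt, pow_succ]
  have hp : g p = 0 := by simp [g]
  rw [Finset.sum_congr rfl fun q _ => hg q, ← zero_add (∑ q, _), ← hp, ← Fin.sum_univ_succAbove g]
  simp only [g, Finset.sum_sub_distrib, ← Finset.sum_filter, Finset.filter_gt_eq_Iio,
    Finset.filter_lt_eq_Ioi]

theorem sum_sum_neg_one_pow_mul_succAbove (H : Fin (n + 1) → Fin (n + 1) → ℂ) :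
    ∑ p : Fin (n + 1), (-1) ^ p.val * ∑ q : Fin n, (-1) ^ q.val * H p (p.succAbove q) =
      ∑ i, ∑ j ∈ Finset.Ioi i, (-1) ^ (i.val + j.val) * (H j i - H i j) := by
  simp only [sum_neg_one_pow_mul_succAbove, mul_sub, Finset.mul_sum, Finset.sum_sub_distrib,
    ← mul_assoc, ← pow_add]
  congr 1
  rw [Finset.sum_comm' (t' := Finset.univ) (s' := fun i => Finset.Ioi i) (by simp)]
  simp only [add_comm]

theorem sum_sum_Ioi_neg_one_pow (n : ℕ) :
    ∑ i : Fin n, ∑ j ∈ Finset.Ioi i, (-1 : ℂ) ^ (i.val + j.val) = -(n / 2 : ℕ) := by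
  induction n with
  | zero => simp
  | succ n ih =>
    have hsum : ∑ j : Fin n, (-1 : ℂ) ^ j.val = if Even n then 0 else 1 := by
      rw [Fin.sum_univ_eq_sum_range (fun j => (-1 : ℂ) ^ j), neg_one_geom_sum]
    have hzero : ∑ j : Fin n, (-1 : ℂ) ^ (0 + j.succ.val) = -if Even n then 0 else 1 := by
      simp only [zero_add, Fin.val_succ, pow_succ, mul_neg_one, Finset.sum_neg_distrib, hsum]
    have hsucc (i j : Fin n) : (-1 : ℂ) ^ (i.succ.val + j.succ.val) = (-1) ^ (i.val + j.val) := by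
      rw [Fin.val_succ, Fin.val_succ, add_add_add_comm, pow_add, neg_one_pow_two, mul_one]
    simp only [Fin.sum_univ_succ, Fin.sum_Ioi_zero, Fin.sum_Ioi_succ, Fin.val_zero, hzero, hsucc,
      ih]
    split_ifs with hn
    · rw [show (n + 1) / 2 = n / 2 by grind, neg_zero, zero_add]
    · rw [show (n + 1) / 2 = n / 2 + 1 by grind, Nat.cast_add_one]
      ring

end PairSum

section AlternatingPairSum

variable {M : Type*} [Monoid M] {n : ℕ}

/-- The sum of `± G` over all words with one letter `a`, one letter `b` and all other letters `1`,
where the sign is that of the permutation which moves `a` and `b` to the front: it is what remains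
of an alternation of `G` in which all letters except `a` and `b` are `1`. -/
def alternatingPairSum (G : (Fin n → M) → ℂ) (a b : M) : ℂ :=
  ∑ i, ∑ j ∈ Finset.Ioi i,
    (-1) ^ (i.val + j.val) * (G (pairWord i j b a) - G (pairWord i j a b))

theorem alternatingPairSum_sub (G H : (Fin n → M) → ℂ) (a b : M) :
    alternatingPairSum (fun w => G w - H w) a b =
      alternatingPairSum G a b - alternatingPairSum H a b := by
  simp only [alternatingPairSum, ← Finset.sum_sub_distrib, ← mul_sub, sub_sub_sub_comm]

theorem alternatingPairSum_eq_sum_insertNth (G : (Fin (n + 2) → M) → ℂ) (a b : M) :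
    alternatingPairSum G a b = ∑ p : Fin (n + 2), (-1) ^ p.val * ∑ q : Fin (n + 1),
      (-1) ^ q.val * G (p.insertNth a (q.insertNth b 1 : Fin (n + 1) → M)) := by
  simp only [insertNth_insertNth_one]
  rw [sum_sum_neg_one_pow_mul_succAbove fun i j => G (pairWord i j a b), alternatingPairSum]
  refine Finset.sum_congr rfl fun i _ => Finset.sum_congr rfl fun j hj => ?_
  rw [pairWord_comm (Finset.mem_Ioi.1 hj).ne' a b]

theorem alternatingPairSum_prod (k : ℕ) (g : M → ℂ) (a b : M) :
    alternatingPairSum (fun w : Fin (2 * k + 1) → M => g (List.ofFn w).prod) a b =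
      k * (g (a * b) - g (b * a)) := by
  have hprod (i : Fin (2 * k + 1)) (j) (hj : j ∈ Finset.Ioi i) :
      (-1 : ℂ) ^ (i.val + j.val) * (g (List.ofFn (pairWord i j b a)).prod -
        g (List.ofFn (pairWord i j a b)).prod) =
      (-1) ^ (i.val + j.val) * (g (b * a) - g (a * b)) := by
    rw [prod_ofFn_pairWord (Finset.mem_Ioi.1 hj), prod_ofFn_pairWord (Finset.mem_Ioi.1 hj)]
  rw [alternatingPairSum, Finset.sum_congr rfl fun i _ => Finset.sum_congr rfl (hprod i)]
  simp only [← Finset.sum_mul]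
  rw [sum_sum_Ioi_neg_one_pow, show (2 * k + 1) / 2 = k by omega]
  ring

end AlternatingPairSum

section LiftingWord

variable {R : Type*} [Ring R] {n s : ℕ}

theorem liftingWord_pairWord {D D' : R → R} (hD : D 1 = 0) (hD' : D' 1 = 0) (hs : 1 ≤ s)
    (hsn : 2 * s ≤ n) {i j : Fin n} (hij : i < j) (a b : R) :
    liftingWord D D' s (pairWord i j a b) =
      if i.val = 0 ∧ j.val + 1 = 2 * s then D a * D' b else 0 := by
  rw [liftingWord]
  split_ifs with h
  · rw [prod_ofFn_eq_mul hij, if_pos h.1, if_neg (by omega), if_pos h.2, pairWord_left hij.ne,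
      pairWord_right]
    intro l hi hj
    rw [if_neg fun hl => hi (Fin.ext (hl.trans h.1.symm)),
      if_neg fun hl => hj (Fin.ext (by omega)), pairWord_of_ne hi hj]
  · refine List.prod_eq_zero (List.mem_ofFn.2 ?_)
    by_cases hi : i.val = 0
    · refine ⟨⟨2 * s - 1, by omega⟩, ?_⟩
      rw [if_neg (by simp only; omega), if_pos (by simp only; omega), pairWord_of_ne, hD'] <;>
        simp only [ne_eq, Fin.ext_iff] <;> omega
    · refine ⟨⟨0, by omega⟩, ?_⟩
      rw [if_pos rfl, pairWord_of_ne, hD] <;> simp only [ne_eq, Fin.ext_iff] <;> omega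

theorem alternatingPairSum_liftingWord {D D' : R → R} (hD : D 1 = 0) (hD' : D' 1 = 0)
    (hs : 1 ≤ s) (hsn : 2 * s ≤ n) {g : R → ℂ} (hg : g 0 = 0) (a b : R) :
    alternatingPairSum (fun w : Fin n → R => g (liftingWord D D' s w)) a b =
      g (D a * D' b) - g (D b * D' a) := by
  have hval (i j : Fin n) (hj : j ∈ Finset.Ioi i) :
      (-1 : ℂ) ^ (i.val + j.val) * (g (liftingWord D D' s (pairWord i j b a)) -
        g (liftingWord D D' s (pairWord i j a b))) =
      if i.val = 0 ∧ j.val + 1 = 2 * s then g (D a * D' b) - g (D b * D' a) else 0 := by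
    rw [liftingWord_pairWord hD hD' hs hsn (Finset.mem_Ioi.1 hj),
      liftingWord_pairWord hD hD' hs hsn (Finset.mem_Ioi.1 hj)]
    split_ifs with h
    · rw [Odd.neg_one_pow (by grind), neg_one_mul, neg_sub]
    · rw [hg, sub_zero, mul_zero]
  rw [alternatingPairSum, Finset.sum_congr rfl fun i _ => Finset.sum_congr rfl (hval i),
    Finset.sum_eq_single ⟨0, by omega⟩, Finset.sum_eq_single ⟨2 * s - 1, by omega⟩]
  · exact if_pos ⟨rfl, by simp only; omega⟩
  · exact fun j _ hj => if_neg fun h => hj (Fin.ext (by simp only; omega))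
  · exact fun h => (h (Finset.mem_Ioi.2 (Fin.mk_lt_mk.2 (by omega)))).elim
  · exact fun i _ hi => Finset.sum_eq_zero fun j _ => if_neg fun h => hi (Fin.ext h.1)
  · exact fun h => (h (Finset.mem_univ _)).elim

theorem sum_liftingWeight {k : ℕ} (hk : 1 ≤ k) :
    ∑ s ∈ Finset.Icc 1 k, liftingWeight k s = (k + 1) / 2 := by
  have hone (j : ℕ) (hj : 2 * j ≤ k + 1) : ∑ s ∈ Finset.Icc 1 j, liftingWeight k s = j := by
    rw [Finset.sum_congr rfl fun s hs => by
      rw [liftingWeight, if_pos (by rw [Finset.mem_Icc] at hs; omega)]]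
    simp
  have htail (j : ℕ) (hj : j ≤ k) (hjk : k < 2 * j) :
      ∑ s ∈ Finset.Icc 1 k, liftingWeight k s = ∑ s ∈ Finset.Icc 1 j, liftingWeight k s := by
    refine (Finset.sum_subset (Finset.Icc_subset_Icc_right hj) fun s hs hsj => ?_).symm
    rw [Finset.mem_Icc] at hs hsj
    rw [liftingWeight, if_neg (by omega), if_neg (by omega)]
  obtain ⟨j, hj | hj⟩ := Nat.even_or_odd' k
  · rw [htail (j + 1) (by omega) (by omega), Finset.sum_Icc_succ_top (by omega), hone j (by omega),
      liftingWeight, if_neg (by omega), if_pos (by omega), hj]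
    push_cast
    ring
  · rw [htail (j + 1) (by omega) (by omega), hone (j + 1) (by omega), hj]
    push_cast
    ring

end LiftingWord

section Tensor

namespace InfMat

variable {R : Type*} [Ring R] [Algebra ℂ R] {n : ℕ}

/-- The matrix `M ⊗ r` with entries `Mᵢⱼ r`. -/
def tensor (r : R) (M : InfMat ℂ) : InfMat R := M.map (fun c => c • r) (zero_smul ℂ r)

theorem tensor_mul_tensor (r t : R) (M N : InfMat ℂ) :
    tensor r M * tensor t N = tensor (r * t) (M * N) := by
  ext1
  funext i j
  have hM (l : ℕ) (hl : M.entry i l ≠ 0) : l ∈ (M.row_finite i).toFinset := by simpa using hl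
  have hrM (l : ℕ) (hl : (tensor r M).entry i l ≠ 0) : l ∈ (M.row_finite i).toFinset :=
    hM l (left_ne_zero_of_smul hl)
  rw [mul_entry_eq_row _ _ i j _ hrM]
  change ∑ l ∈ _, (M.entry i l • r) * (N.entry l j • t) = (M * N).entry i j • (r * t)
  simp only [mul_entry_eq_row M N i j _ hM, Finset.sum_smul, smul_mul_smul_comm]

theorem tensor_one (r : R) : tensor r 1 = scalar r := by
  ext1
  funext i j
  exact (ite_smul ..).trans (by rw [one_smul, zero_smul]; rfl)

theorem prod_ofFn_tensor (r : Fin n → R) (M : Fin n → InfMat ℂ) :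
    (List.ofFn fun j => tensor (r j) (M j)).prod =
      tensor (List.ofFn r).prod (List.ofFn M).prod := by
  induction n with
  | zero => exact (tensor_one 1).symm
  | succ n ih => simp only [List.ofFn_succ, List.prod_cons, ← tensor_mul_tensor, ih]

theorem map_tensor (D : R →ₗ[ℂ] R) (r : R) (M : InfMat ℂ) :
    (tensor r M).map D (map_zero D) = tensor (D r) M := by
  ext1
  funext i j
  exact map_smul D _ _

theorem trace_tensor (τ : R →ₗ[ℂ] ℂ) (r : R) (M : InfMat ℂ) :
    trace τ (tensor r M) = τ r * trace id M := by
  rw [trace, trace, mul_finsum]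
  exact finsum_congr fun i => (map_smul τ _ r).trans (mul_comm _ _)

theorem insertNth_tensor (p : Fin (n + 1)) (r : Fin n → R) (M : Fin n → InfMat ℂ) (a : R) :
    (p.insertNth (scalar a) (fun j => tensor (r j) (M j)) : Fin (n + 1) → InfMat R) =
      fun j => tensor ((p.insertNth a r : Fin (n + 1) → R) j)
        ((p.insertNth 1 M : Fin (n + 1) → InfMat ℂ) j) := by
  funext j
  induction j using p.succAboveCases with
  | x => simp only [Fin.insertNth_apply_same, tensor_one]
  | p j => simp only [Fin.insertNth_apply_succAbove]

theorem liftingWord_tensor (D D' : R →ₗ[ℂ] R) (s : ℕ) (r : Fin n → R) (M : Fin n → InfMat ℂ) :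
    liftingWord (map D (map_zero D)) (map D' (map_zero D')) s (fun j => tensor (r j) (M j)) =
      tensor (liftingWord D D' s r) (List.ofFn M).prod := by
  rw [liftingWord, liftingWord, ← prod_ofFn_tensor]
  congr 2
  funext j
  rw [map_tensor, map_tensor]
  split_ifs <;> rfl

/-- The alternated trace `∑_σ sgn σ · tr (B_{σ 1} ⋯ B_{σ n})`. -/
def alternateTrace (B : Fin n → InfMat ℂ) : ℂ :=
  alternate (fun B => trace id (List.ofFn B).prod) B

theorem alternate_cons_cons_tensor {F : (Fin (n + 2) → InfMat R) → ℂ}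
    {G : (Fin (n + 2) → R) → ℂ}
    (hFG : ∀ r M, F (fun j => tensor (r j) (M j)) = G r * trace id (List.ofFn M).prod)
    (a b : R) (B : Fin n → InfMat ℂ) :
    alternate F (Fin.cons (scalar a) (Fin.cons (scalar b) fun j => tensor 1 (B j) :
        Fin (n + 1) → InfMat R)) =
      alternatingPairSum G a b * alternateTrace B := by
  have hword (p : Fin (n + 2)) (q : Fin (n + 1)) (w : Fin n → InfMat ℂ) :
      F (p.insertNth (scalar a) (q.insertNth (scalar b) fun j => tensor 1 (w j) :
        Fin (n + 1) → InfMat R)) =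
      G (p.insertNth a (q.insertNth b 1 : Fin (n + 1) → R)) * trace id (List.ofFn w).prod := by
    rw [insertNth_tensor q (fun _ => 1) w b, insertNth_tensor, hFG, prod_ofFn_insertNth_one,
      prod_ofFn_insertNth_one]
    rfl
  have hinner (p : Fin (n + 2)) (q : Fin (n + 1)) :
      alternate (fun w => F (p.insertNth (scalar a) (q.insertNth (scalar b) w :
        Fin (n + 1) → InfMat R))) (fun j => tensor 1 (B j)) =
      G (p.insertNth a (q.insertNth b 1 : Fin (n + 1) → R)) * alternateTrace B := by
    refine Eq.trans ?_ (map_alternate (AddMonoidHom.mulLeft (G _)) _ B).symm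
    exact congrArg (alternate · B) (funext fun w => hword p q w)
  simp only [alternate_cons, hinner, alternatingPairSum_eq_sum_insertNth, zsmul_eq_mul,
    Int.cast_pow, Int.cast_neg, Int.cast_one, Finset.sum_mul, mul_assoc]

theorem alternate_trace_scalar_mul_cons_cons_tensor (τ : R →ₗ[ℂ] ℂ) (q a b : R) (m : ℕ)
    (B : Fin (2 * m + 1) → InfMat ℂ) :
    alternate (fun A => trace τ (scalar q * (List.ofFn A).prod))
        (Fin.cons (scalar a) (Fin.cons (scalar b) fun j => tensor 1 (B j) :
          Fin (2 * m + 2) → InfMat R)) =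
      (m + 1) * τ (q * (a * b - b * a)) * alternateTrace B := by
  rw [alternate_cons_cons_tensor (G := fun w => τ (q * (List.ofFn w).prod)) fun r M => by
    rw [prod_ofFn_tensor, ← tensor_one, tensor_mul_tensor, one_mul, trace_tensor]]
  refine congrArg (· * _) ((alternatingPairSum_prod (m + 1) (fun r => τ (q * r)) a b).trans ?_)
  rw [Nat.cast_add_one, mul_sub q, map_sub]

theorem alternate_trace_liftingWord_cons_cons_tensor (τ : R →ₗ[ℂ] ℂ) {D D' : R →ₗ[ℂ] R}
    (hD : D 1 = 0) (hD' : D' 1 = 0) {s : ℕ} (hs : 1 ≤ s) (hsn : 2 * s ≤ n + 2) (a b : R)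
    (B : Fin n → InfMat ℂ) :
    alternate (fun A => trace τ (liftingWord (map D (map_zero D)) (map D' (map_zero D')) s A) -
        trace τ (liftingWord (map D' (map_zero D')) (map D (map_zero D)) s A))
        (Fin.cons (scalar a) (Fin.cons (scalar b) fun j => tensor 1 (B j) :
          Fin (n + 1) → InfMat R)) =
      (τ (D a * D' b) - τ (D b * D' a) - (τ (D' a * D b) - τ (D' b * D a))) *
        alternateTrace B := by
  rw [← alternatingPairSum_liftingWord hD hD' hs hsn (map_zero τ),
    ← alternatingPairSum_liftingWord hD' hD hs hsn (map_zero τ), ← alternatingPairSum_sub]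
  refine alternate_cons_cons_tensor (fun r M => ?_) a b B
  rw [liftingWord_tensor, liftingWord_tensor, trace_tensor, trace_tensor, sub_mul]

theorem lifting_cons_cons_tensor (τ : R →ₗ[ℂ] ℂ) {D₁ D₂ : R →ₗ[ℂ] R} (hD₁ : D₁ 1 = 0)
    (hD₂ : D₂ 1 = 0) (q a b : R) (m : ℕ) (B : Fin (2 * m + 1) → InfMat ℂ) :
    lifting (trace τ) (map D₁ (map_zero D₁)) (map D₂ (map_zero D₂)) (scalar q) (m + 1)
        (Fin.cons (scalar a) (Fin.cons (scalar b) fun j => tensor 1 (B j) :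
          Fin (2 * m + 2) → InfMat R)) =
      ((m + 1) * τ (q * (a * b - b * a)) + (m + 2) / 2 *
        (τ (D₁ a * D₂ b) - τ (D₁ b * D₂ a) - (τ (D₂ a * D₁ b) - τ (D₂ b * D₁ a)))) *
        alternateTrace B := by
  refine (congrArg₂ (· + ·) (alternate_trace_scalar_mul_cons_cons_tensor τ q a b m B)
    (Finset.sum_congr rfl fun s hs => congrArg (liftingWeight (m + 1) s * ·)
      (alternate_trace_liftingWord_cons_cons_tensor τ hD₁ hD₂ (Finset.mem_Icc.1 hs).1
        (by grind) a b B))).trans ?_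
  rw [← Finset.sum_mul, sum_liftingWeight (by omega)]
  push_cast
  ring

end InfMat

theorem tensorOne_eq_tensor (A : glFin) : tensorOne A = tensor 1 A := by
  ext1
  funext i j
  exact const_eq_smul_one _

theorem PsiContracted_succ_eq_Psi (m : ℕ) (A : Fin (2 * m + 1) → glFin) :
    PsiContracted (m + 1) A = Psi (m + 1)
      (Fin.cons (scalar d) (Fin.cons (scalar x2d) fun j => tensor 1 (A j : InfMat ℂ) :
        Fin (2 * m + 2) → InfMat PsiDif)) := by
  refine congrArg (Psi (m + 1)) (funext fun j : Fin (2 * m + 1 + 2) => ?_)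
  cases j using Fin.cases with
  | zero => rfl
  | succ j =>
    cases j using Fin.cases with
    | zero => rfl
    | succ j => exact tensorOne_eq_tensor (A j)

theorem PsiContracted_succ (m : ℕ) (A : Fin (2 * m + 1) → glFin) :
    PsiContracted (m + 1) A =
      -(2 * (m + 1 : ℕ) + 1 : ℂ) * alternateTrace fun j => (A j : InfMat ℂ) := by
  have h := lifting_cons_cons_tensor resLin (D₁ := adLogDLin) (D₂ := adLogXLin) adLogD_one
    adLogX_one Q d x2d m fun j => (A j : InfMat ℂ)
  have hd : adLogDLin d = 0 := adLogD_d
  have hxd : resLin (adLogDLin x2d * adLogXLin d) = 1 := res_adLogD_x2d_mul_adLogX_d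
  have hdx : resLin (adLogXLin d * adLogDLin x2d) = 1 := res_adLogX_d_mul_adLogD_x2d
  have hQ : resLin (Q * (d * x2d - x2d * d)) = -1 := res_Q_mul_commutator
  rw [PsiContracted_succ_eq_Psi]
  refine h.trans ?_
  rw [hd, hxd, hdx, hQ, zero_mul, mul_zero, map_zero]
  push_cast
  ring

end Tensor

section Trace

theorem InfMat.IsFin.prod_ofFn {n : ℕ} {B : Fin (n + 1) → InfMat ℂ} (hB : ∀ j, (B j).IsFin) :
    (List.ofFn B).prod.IsFin := by
  induction n with
  | zero => simpa using hB 0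
  | succ n ih =>
    rw [List.ofFn_succ, List.prod_cons]
    exact (hB 0).mul (ih fun j => hB j.succ)

/-- The trace of matrices with finitely many nonzero entries, as an additive map. -/
def glFin.traceHom : glFin →+ ℂ where
  toFun A := trace id (A : InfMat ℂ)
  map_zero' := finsum_eq_zero_of_forall_eq_zero fun _ => rfl
  map_add' A B := by
    have hfin (C : glFin) : (Function.support fun i => (C : InfMat ℂ).entry i i).Finite :=
      (C.2.image Prod.fst).subset fun i hi => ⟨(i, i), hi, rfl⟩
    exact finsum_add_distrib (hfin A) (hfin B)

theorem trace_sum_alternate_prod {ι : Type*} (s : Finset ι) {n : ℕ}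
    (A : ι → Fin (n + 1) → glFin) :
    trace id (∑ i ∈ s, alternate (fun B : Fin (n + 1) → InfMat ℂ => (List.ofFn B).prod)
        fun j => (A i j : InfMat ℂ)) =
      ∑ i ∈ s, alternateTrace fun j => (A i j : InfMat ℂ) := by
  let prodFin (B : Fin (n + 1) → glFin) : glFin :=
    ⟨(List.ofFn fun j => (B j : InfMat ℂ)).prod, IsFin.prod_ofFn fun j => (B j).2⟩
  have hcoe (i : ι) : alternate (fun B : Fin (n + 1) → InfMat ℂ => (List.ofFn B).prod)
      (fun j => (A i j : InfMat ℂ)) = ((alternate prodFin (A i) : glFin) : InfMat ℂ) :=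
    (map_alternate glFin.toSubmodule.subtype.toAddMonoidHom prodFin (A i)).symm
  calc
    _ = glFin.traceHom (∑ i ∈ s, alternate prodFin (A i)) := by
      simp only [hcoe]
      exact congrArg (trace id) (map_sum glFin.toSubmodule.subtype.toAddMonoidHom _ s).symm
    _ = _ := by
      rw [map_sum]
      exact Finset.sum_congr rfl fun i _ => map_alternate glFin.traceHom prodFin (A i)

end Trace

section AnticommutingEntries

open Finset.HasAntidiagonal (antidiagonal mem_antidiagonal)

variable {κ R : Type*} [Fintype κ] [DecidableEq κ] [Ring R]

theorem trace_neg_pow_mul_diagonal_sub_smul_pow (X : Matrix κ κ R) (c : R)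
    (N m n : ℕ) :
    ((-X) ^ m * (Matrix.diagonal (fun _ => c) - N • X ^ n)).trace =
      (-1) ^ m * ((X ^ m).trace * c - N • (X ^ (m + n)).trace) := by
  have hdiagonal : (X ^ m * Matrix.diagonal fun _ => c).trace = (X ^ m).trace * c := by
    simp only [Matrix.trace, Matrix.diag, Matrix.mul_diagonal, Finset.sum_mul]
  have htrace : (X ^ m * (Matrix.diagonal (fun _ => c) - N • X ^ n)).trace =
      (X ^ m).trace * c - N • (X ^ (m + n)).trace := by
    rw [mul_sub, Matrix.trace_sub, hdiagonal, mul_smul_comm, ← pow_add, Matrix.trace_smul]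
  rcases Nat.even_or_odd m with hm | hm
  · rw [hm.neg_pow, htrace, hm.neg_one_pow, one_mul]
  · rw [hm.neg_pow, neg_mul, Matrix.trace_neg, htrace, hm.neg_one_pow, neg_one_mul]

variable {X : Matrix κ κ R}

theorem apply_mul_pow_apply (hX : ∀ i j k l, X i j * X k l = -(X k l * X i j)) (n : ℕ)
    (a b i j : κ) : X a b * (X ^ n) i j = (-1) ^ n * ((X ^ n) i j * X a b) := by
  induction n generalizing i with
  | zero =>
    rw [pow_zero, pow_zero, one_mul, Matrix.one_apply]
    split_ifs
    · rw [one_mul, mul_one]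
    · rw [zero_mul, mul_zero]
  | succ n ih =>
    simp only [pow_succ' X, Matrix.mul_apply, Finset.mul_sum, Finset.sum_mul]
    refine Finset.sum_congr rfl fun l _ => ?_
    rw [← mul_assoc, hX, neg_mul, mul_assoc, ih, pow_succ, mul_neg_one, neg_mul, mul_assoc,
      ((Commute.neg_one_right (X i l)).pow_right n).left_comm]

theorem pow_apply_mul_pow_apply (hX : ∀ i j k l, X i j * X k l = -(X k l * X i j)) (m n : ℕ)
    (a b i j : κ) :
    (X ^ m) a b * (X ^ n) i j = (-1) ^ (m * n) * ((X ^ n) i j * (X ^ m) a b) := by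
  induction m generalizing a with
  | zero =>
    rw [pow_zero, zero_mul, pow_zero, one_mul, Matrix.one_apply]
    split_ifs
    · rw [one_mul, mul_one]
    · rw [zero_mul, mul_zero]
  | succ m ih =>
    simp only [pow_succ' X, Matrix.mul_apply, Finset.mul_sum, Finset.sum_mul]
    refine Finset.sum_congr rfl fun l _ => ?_
    rw [mul_assoc, ih, ((Commute.neg_one_right (X a l)).pow_right (m * n)).left_comm,
      ← mul_assoc (X a l), apply_mul_pow_apply hX, add_mul, one_mul, pow_add]
    simp only [mul_assoc]

theorem trace_pow_mul_trace_pow (hX : ∀ i j k l, X i j * X k l = -(X k l * X i j)) (m n : ℕ) :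
    (X ^ m).trace * (X ^ n).trace = (-1) ^ (m * n) * ((X ^ n).trace * (X ^ m).trace) := by
  rw [Matrix.trace, Matrix.trace, Finset.sum_mul_sum, Finset.sum_mul_sum, Finset.mul_sum,
    Finset.sum_comm]
  simp only [Finset.mul_sum]
  exact Finset.sum_congr rfl fun i _ => Finset.sum_congr rfl fun j _ =>
    pow_apply_mul_pow_apply hX m n j j i i

variable [IsAddTorsionFree R]

theorem trace_pow_eq_zero (hX : ∀ i j k l, X i j * X k l = -(X k l * X i j)) {n : ℕ}
    (hn : Even n) (hn₀ : n ≠ 0) : (X ^ n).trace = 0 := by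
  obtain ⟨m, rfl⟩ := Nat.exists_eq_succ_of_ne_zero hn₀
  have hm : Odd m := by rwa [Nat.succ_eq_add_one, Nat.even_add_one, Nat.not_even_iff_odd] at hn
  refine self_eq_neg.1 ?_
  calc
    (X ^ (m + 1)).trace = ∑ i, ∑ j, X i j * (X ^ m) j i := by
      simp only [pow_succ', Matrix.trace, Matrix.diag, Matrix.mul_apply]
    _ = -∑ i, ∑ j, (X ^ m) j i * X i j := by
      simp only [apply_mul_pow_apply hX, hm.neg_one_pow, neg_one_mul, Finset.sum_neg_distrib]
    _ = -(X ^ (m + 1)).trace := by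
      rw [Finset.sum_comm]
      simp only [pow_succ, Matrix.trace, Matrix.diag, Matrix.mul_apply]

theorem sum_antidiagonal_trace_pow_mul_trace_pow
    (hX : ∀ i j k l, X i j * X k l = -(X k l * X i j)) {n : ℕ} (hn : Even n) (hn₀ : n ≠ 0) :
    ∑ p ∈ antidiagonal n, (-1) ^ p.1 * ((X ^ p.1).trace * (X ^ p.2).trace) = 0 := by
  let f (p : ℕ × ℕ) : R := (-1) ^ p.1 * ((X ^ p.1).trace * (X ^ p.2).trace)
  have hswap (p : ℕ × ℕ) (hp : p ∈ antidiagonal n) : f p.swap = -f p := by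
    obtain ⟨l, m⟩ := p
    replace hp : l + m = n := mem_antidiagonal.1 hp
    rw [← hp, Nat.even_add] at hn
    change (-1) ^ m * ((X ^ m).trace * (X ^ l).trace) =
      -((-1) ^ l * ((X ^ l).trace * (X ^ m).trace))
    rcases Nat.even_or_odd l with hl | hl
    · have hzero : (X ^ l).trace = 0 ∨ (X ^ m).trace = 0 := by
        by_cases hl₀ : l = 0
        · exact .inr (trace_pow_eq_zero hX (hn.1 hl) (by omega))
        · exact .inl (trace_pow_eq_zero hX hl hl₀)
      rcases hzero with h | h <;> rw [h, mul_zero, zero_mul, mul_zero, mul_zero, neg_zero]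
    · have hm : Odd m := by rwa [← Nat.not_even_iff_odd, ← hn, Nat.not_even_iff_odd]
      rw [trace_pow_mul_trace_pow hX m l, (hm.mul hl).neg_one_pow, hm.neg_one_pow, hl.neg_one_pow,
        neg_one_mul, neg_one_mul]
  refine self_eq_neg.1 ?_
  rw [← Finset.sum_neg_distrib, ← Finset.Nat.sum_antidiagonal_swap]
  exact Finset.sum_congr rfl hswap

end AnticommutingEntries

section Wedge

open ExteriorAlgebra (ι)

variable {L : Type*} [AddCommGroup L] [Module ℂ L] {n : ℕ}

/-- The element `x₁ ∧ … ∧ x_n` of the exterior algebra. -/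
def wedge (x : Fin n → L) : ExteriorAlgebra ℂ L := (List.ofFn fun t => ι ℂ (x t)).prod

theorem wedge_cons (a : L) (w : Fin n → L) :
    wedge (Fin.cons a w : Fin (n + 1) → L) = ι ℂ a * wedge w := by
  simp only [wedge, List.ofFn_succ, List.prod_cons, Fin.cons_zero, Fin.cons_succ]

theorem ι_mul_ι_eq_neg (x y : L) : ι ℂ x * ι ℂ y = -(ι ℂ y * ι ℂ x) :=
  eq_neg_of_add_eq_zero_left (ExteriorAlgebra.ι_add_mul_swap x y)

theorem neg_one_pow_smul_ι_mul_prod_ne (y : L) (w : Fin n → L) (b : Fin n) :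
    (-1 : ℂ) ^ b.val • (ι ℂ y * (((List.finRange n).filter fun l => l ≠ b).map
      fun l => ι ℂ (w l)).prod) = wedge (Function.update w b y) := by
  induction n with
  | zero => exact b.elim0
  | succ n ih =>
    rw [← Fin.cons_self_tail w]
    generalize w 0 = a
    generalize Fin.tail w = v
    rw [List.finRange_succ]
    cases b using Fin.cases with
    | zero =>
      rw [Fin.update_cons_zero, wedge_cons, List.filter_cons_of_neg (by simp), List.filter_map,
        List.map_map, List.filter_eq_self.2 (by simp)]
      simp [wedge, Function.comp_def, List.ofFn_eq_map]
    | succ b =>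
      rw [← Fin.cons_update, wedge_cons, ← ih,
        List.filter_cons_of_pos (by simpa using (Fin.succ_ne_zero b).symm), List.filter_map,
        List.map_cons, List.prod_cons, List.map_map, ← mul_assoc, ι_mul_ι_eq_neg, Fin.val_succ,
        pow_succ, mul_neg_one, neg_smul, neg_mul, smul_neg, neg_neg, mul_smul_comm, mul_assoc]
      simp [Function.comp_def]

end Wedge

section Boundary

open ExteriorAlgebra (ι)

variable {L : Type*} [LieRing L] [LieAlgebra ℂ L] {n : ℕ}

/-- The adjoint action `∑ⱼ x₁ ∧ … ∧ [y, xⱼ] ∧ … ∧ x_n` of `y` on `x₁ ∧ … ∧ x_n`. -/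
def lieWedge (y : L) (x : Fin n → L) : ExteriorAlgebra ℂ L :=
  ∑ j, wedge (Function.update x j ⁅y, x j⁆)

theorem lieWedge_cons (y a : L) (w : Fin n → L) :
    lieWedge y (Fin.cons a w : Fin (n + 1) → L) =
      ι ℂ ⁅y, a⁆ * wedge w + ι ℂ a * lieWedge y w := by
  simp only [lieWedge, Fin.sum_univ_succ, Fin.cons_zero, Fin.cons_succ, Fin.update_cons_zero,
    ← Fin.cons_update, wedge_cons, Finset.mul_sum]

theorem boundary_fin_zero (x : Fin 0 → L) : boundary x = 0 := Fin.sum_univ_zero _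

theorem boundary_cons (a : L) (w : Fin n → L) :
    boundary (Fin.cons a w : Fin (n + 1) → L) = -lieWedge a w - ι ℂ a * boundary w := by
  rw [boundary, Fin.sum_univ_succ, sub_eq_add_neg]
  congr 1
  · rw [Fin.Ioi_zero_eq_map, Finset.sum_map, lieWedge, ← Finset.sum_neg_distrib]
    refine Finset.sum_congr rfl fun b _ => ?_
    rw [← neg_one_pow_smul_ι_mul_prod_ne, List.finRange_succ, List.filter_cons_of_neg (by simp),
      List.filter_map, List.map_map]
    simp [pow_succ, Function.comp_def]
  · rw [boundary, Finset.mul_sum, ← Finset.sum_neg_distrib]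
    refine Finset.sum_congr rfl fun c _ => ?_
    rw [← Fin.map_succEmb_Ioi, Finset.sum_map, Finset.mul_sum, ← Finset.sum_neg_distrib]
    refine Finset.sum_congr rfl fun b _ => ?_
    have hsign : (-1 : ℂ) ^ (c.succ.val + b.succ.val) = (-1) ^ (c.val + b.val) := by
      rw [Fin.val_succ, Fin.val_succ, add_add_add_comm, pow_add, neg_one_pow_two, mul_one]
    rw [List.finRange_succ, List.filter_cons_of_pos (by simp [eq_comm]),
      List.filter_map, List.map_cons, List.prod_cons, List.map_map, ← mul_assoc, ι_mul_ι_eq_neg,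
      mul_smul_comm, neg_mul, smul_neg, mul_assoc, Fin.coe_succEmb, hsign]
    simp [Function.comp_def]

end Boundary

section PathSum

variable {κ L A : Type*} [Fintype κ] [DecidableEq κ] {n : ℕ}

/-- The matrix whose `(i, j)` entry is the sum of `g (e i l₁, e l₁ l₂, …, e l_{n-1} j)` over the
paths with `n` edges from `i` to `j`. -/
def pathSum [Semiring A] (e : κ → κ → L) : ((Fin n → L) → A) →ₗ[A] Matrix κ κ A where
  toFun g := .of fun i j => ∑ v : Fin (n + 1) → κ,
    if v 0 = i ∧ v (Fin.last n) = j then g fun t => e (v t.castSucc) (v t.succ) else 0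
  map_add' g h := by
    ext i j
    simp only [Matrix.add_apply, Matrix.of_apply, Pi.add_apply, ← Finset.sum_add_distrib,
      ite_add_ite, add_zero]
  map_smul' c g := by
    ext i j
    simp only [Matrix.smul_apply, Matrix.of_apply, Pi.smul_apply, RingHom.id_apply,
      Finset.smul_sum, smul_ite, smul_zero]

section Semiring

variable [Semiring A] (e : κ → κ → L)

theorem pathSum_apply (g : (Fin n → L) → A) (i j : κ) :
    pathSum e g i j = ∑ v : Fin (n + 1) → κ,
      if v 0 = i ∧ v (Fin.last n) = j then g fun t => e (v t.castSucc) (v t.succ) else 0 := rfl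

theorem pathSum_zero (g : (Fin 0 → L) → A) :
    pathSum e g = Matrix.diagonal fun _ => g ![] := by
  ext i j
  rw [pathSum_apply, ← (Equiv.funUnique (Fin 1) κ).symm.sum_comp, Matrix.diagonal_apply]
  simp [ite_and, Subsingleton.elim _ (![] : Fin 0 → L)]

theorem pathSum_succ_apply (g : (Fin (n + 1) → L) → A) (i j : κ) :
    pathSum e g i j = ∑ l, pathSum e (fun w => g (Fin.cons (e i l) w)) l j := by
  have hedges (a : κ) (v : Fin (n + 1) → κ) :
      (fun t : Fin (n + 1) => e ((Fin.cons a v : Fin (n + 2) → κ) t.castSucc) (v t)) =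
        Fin.cons (e a (v 0)) fun t => e (v t.castSucc) (v t.succ) := by
    funext t
    cases t using Fin.cases <;> rfl
  simp only [pathSum_apply]
  rw [← (Fin.consEquiv fun _ => κ).sum_comp, Fintype.sum_prod_type, Finset.sum_comm,
    Finset.sum_comm (s := Finset.univ (α := κ))]
  refine Finset.sum_congr rfl fun v _ => ?_
  simp [ite_and, ← Fin.succ_last, hedges]

theorem trace_pathSum (g : (Fin (n + 1) → L) → A) :
    (pathSum e g).trace = ∑ v : Fin (n + 1) → κ, g fun t => e (v t) (v (t + 1)) := by
  have hedges (v : Fin (n + 1) → κ) (t : Fin (n + 1)) :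
      (Fin.snoc v (v 0) : Fin (n + 2) → κ) t.succ = v (t + 1) := by
    cases t using Fin.lastCases with
    | last => rw [Fin.succ_last, Fin.snoc_last, Fin.last_add_one]
    | cast t => rw [← Fin.castSucc_succ, Fin.snoc_castSucc, Fin.coeSucc_eq_succ]
  simp only [Matrix.trace, Matrix.diag, pathSum_apply]
  rw [Finset.sum_comm, ← (Fin.snocEquiv fun _ => κ).sum_comp, Fintype.sum_prod_type,
    Finset.sum_comm]
  refine Finset.sum_congr rfl fun v _ => ?_
  simp [ite_and, hedges]

end Semiring

end PathSum

section GenericMatrix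

open ExteriorAlgebra (ι)

variable {κ L : Type*} [AddCommGroup L] [Module ℂ L] {e : κ → κ → L}

/-- The matrix over the exterior algebra whose `(i, j)` entry is the generator `e i j`. -/
def generic (e : κ → κ → L) : Matrix κ κ (ExteriorAlgebra ℂ L) := .of fun i j => ι ℂ (e i j)

theorem generic_mul_eq_neg (i j k l : κ) :
    generic e i j * generic e k l = -(generic e k l * generic e i j) := ι_mul_ι_eq_neg _ _

variable [Fintype κ] [DecidableEq κ]

theorem pathSum_wedge (n : ℕ) : pathSum e (wedge (n := n)) = generic e ^ n := by
  induction n with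
  | zero => simp [pathSum_zero, wedge, ← Matrix.diagonal_one]
  | succ n ih =>
    ext i j
    rw [pathSum_succ_apply, pow_succ', Matrix.mul_apply, ← ih]
    refine Finset.sum_congr rfl fun l _ => ?_
    rw [funext (wedge_cons (e i l))]
    exact congrFun₂ (map_smul (pathSum e) (ι ℂ (e i l)) wedge) l j

end GenericMatrix

section MatrixUnits

open ExteriorAlgebra (ι)
open Finset.HasAntidiagonal (antidiagonal mem_antidiagonal)

variable {κ L : Type*} [LieRing L] [LieAlgebra ℂ L] {e : κ → κ → L}

/-- The family `e` satisfies the commutation relations of the matrix units of `𝔤𝔩`. -/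
def IsLieMatrixUnits [DecidableEq κ] (e : κ → κ → L) : Prop :=
  ∀ i j k l, ⁅e i j, e k l⁆ = (if j = k then e i l else 0) - if l = i then e k j else 0

variable [Fintype κ] [DecidableEq κ]

theorem pathSum_lieWedge (he : IsLieMatrixUnits e) (n : ℕ) (a b i j : κ) :
    pathSum e (lieWedge (n := n) (e a b)) i j =
      (if b = i then (generic e ^ n) a j else 0) - if j = a then (generic e ^ n) i b else 0 := by
  induction n generalizing i with
  | zero =>
    rw [pathSum_zero, pow_zero, Matrix.one_apply, Matrix.one_apply]
    simp only [lieWedge, Finset.univ_eq_empty, Finset.sum_empty, Matrix.diagonal_zero,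
      Matrix.zero_apply]
    split_ifs <;> simp_all
  | succ n ih =>
    have hlie (l : κ) : ι ℂ ⁅e a b, e i l⁆ =
        (if b = i then generic e a l else 0) - if l = a then generic e i b else 0 := by
      rw [he, map_sub, apply_ite (ι ℂ), apply_ite (ι ℂ), map_zero]
      rfl
    have hstep (l : κ) : pathSum e (fun w => lieWedge (n := n + 1) (e a b) (Fin.cons (e i l) w)) l j
        = ι ℂ ⁅e a b, e i l⁆ * (generic e ^ n) l j +
          generic e i l * pathSum e (lieWedge (n := n) (e a b)) l j := by
      rw [funext (lieWedge_cons (e a b) (e i l)), ← pathSum_wedge]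
      exact congrFun₂ ((map_add (pathSum e) (ι ℂ ⁅e a b, e i l⁆ • wedge)
        (ι ℂ (e i l) • lieWedge (e a b))).trans (by rw [map_smul, map_smul])) l j
    simp only [pathSum_succ_apply, hstep, ih, hlie, sub_mul, mul_sub, ite_mul, mul_ite, zero_mul,
      mul_zero, Finset.sum_add_distrib, Finset.sum_sub_distrib, Finset.sum_ite_eq',
      Finset.sum_ite_eq, Finset.mem_univ, if_true, pow_succ', Matrix.mul_apply, sub_add_sub_cancel,
      Finset.sum_ite_irrel, Finset.sum_const_zero]

theorem pathSum_boundary_succ (he : IsLieMatrixUnits e) (n : ℕ) :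
    pathSum e (boundary (p := n + 1)) =
      Matrix.diagonal (fun _ => (generic e ^ n).trace) - Fintype.card κ • generic e ^ n -
        generic e * pathSum e (boundary (p := n)) := by
  have hstep (i l j : κ) : pathSum e (fun w => boundary (p := n + 1) (Fin.cons (e i l) w)) l j =
      -pathSum e (lieWedge (n := n) (e i l)) l j -
        generic e i l * pathSum e (boundary (p := n)) l j := by
    rw [funext (boundary_cons (e i l))]
    exact congrFun₂ ((map_sub (pathSum e) (-lieWedge (n := n) (e i l))
      (ι ℂ (e i l) • boundary)).trans (by rw [map_neg, map_smul])) l j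
  ext i j
  simp only [pathSum_succ_apply, hstep, pathSum_lieWedge he, if_true, neg_sub,
    Finset.sum_sub_distrib, Finset.sum_const, Finset.card_univ, Matrix.sub_apply,
    Matrix.smul_apply, Matrix.mul_apply, Matrix.diagonal_apply, Matrix.trace, Matrix.diag]
  by_cases h : i = j
  · simp [h]
  · simp [h, Ne.symm h]

theorem pathSum_boundary (he : IsLieMatrixUnits e) (n : ℕ) :
    pathSum e (boundary (p := n + 1)) = ∑ p ∈ antidiagonal n,
      (-generic e) ^ p.1 * (Matrix.diagonal (fun _ => (generic e ^ p.2).trace) -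
        Fintype.card κ • generic e ^ p.2) := by
  induction n with
  | zero =>
    rw [pathSum_boundary_succ he, pathSum_zero, boundary_fin_zero]
    simp
  | succ n ih =>
    rw [pathSum_boundary_succ he, ih, Finset.Nat.sum_antidiagonal_succ, Finset.mul_sum,
      sub_eq_add_neg, ← Finset.sum_neg_distrib]
    simp only [pow_zero, one_mul, pow_succ' (-generic e), neg_mul, mul_assoc]

theorem trace_pathSum_boundary (he : IsLieMatrixUnits e) {n : ℕ} (hn : Even n) :
    (pathSum e (boundary (p := n + 1))).trace = 0 := by
  have : IsAddTorsionFree (ExteriorAlgebra ℂ L) := .of_isTorsionFree ℂ _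
  have hterm (p : ℕ × ℕ) (hp : p ∈ antidiagonal n) :
      ((-generic e) ^ p.1 * (Matrix.diagonal (fun _ => (generic e ^ p.2).trace) -
          Fintype.card κ • generic e ^ p.2)).trace =
        (-1) ^ p.1 * ((generic e ^ p.1).trace * (generic e ^ p.2).trace -
          Fintype.card κ • (generic e ^ n).trace) := by
    rw [trace_neg_pow_mul_diagonal_sub_smul_pow, mem_antidiagonal.1 hp]
  rw [pathSum_boundary he, Matrix.trace_sum, Finset.sum_congr rfl hterm]
  by_cases hn₀ : n = 0
  · subst hn₀
    simp
  · simp only [trace_pow_eq_zero generic_mul_eq_neg hn hn₀, smul_zero, sub_zero]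
    exact sum_antidiagonal_trace_pow_mul_trace_pow generic_mul_eq_neg hn hn₀

theorem sum_boundary_closedPath (he : IsLieMatrixUnits e) {n : ℕ} (hn : Even n) :
    ∑ v : Fin (n + 1) → κ, boundary (fun t => e (v t) (v (t + 1))) = 0 :=
  (trace_pathSum e boundary).symm.trans (trace_pathSum_boundary he hn)

end MatrixUnits

section Symmetrization

variable {V R : Type*} [CommRing R] {n : ℕ}

theorem alternate_comp_perm (c : (Fin n → V) → R) (I : Fin n → V) (σ : Equiv.Perm (Fin n)) :
    alternate c (I ∘ σ) = (Equiv.Perm.sign σ : ℤ) • alternate c I := by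
  rw [alternate, alternate, Finset.smul_sum, ← (Group.mulLeft_bijective σ⁻¹).sum_comp]
  refine Finset.sum_congr rfl fun τ _ => ?_
  rw [Function.comp_assoc, ← Equiv.Perm.coe_mul, mul_inv_cancel_left, Equiv.Perm.sign_mul,
    Equiv.Perm.sign_inv, Units.val_mul, smul_smul]

theorem sum_alternate_sq [Fintype V] (c : (Fin n → V) → R) :
    ∑ I, alternate c I ^ 2 = n.factorial • ∑ I, c I * alternate c I := by
  have hsq (I : Fin n → V) :
      alternate c I ^ 2 = ∑ σ : Equiv.Perm (Fin n), c (I ∘ σ) * alternate c (I ∘ σ) := by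
    rw [sq]
    nth_rw 1 [alternate]
    simp only [Finset.sum_mul, alternate_comp_perm, smul_mul_assoc, mul_smul_comm]
  have hreindex (σ : Equiv.Perm (Fin n)) :
      ∑ I : Fin n → V, c (I ∘ σ) * alternate c (I ∘ σ) = ∑ I, c I * alternate c I :=
    (σ.arrowCongr (Equiv.refl V)).symm.sum_comp fun I => c I * alternate c I
  rw [Finset.sum_congr rfl fun I _ => hsq I, Finset.sum_comm,
    Finset.sum_congr rfl fun σ _ => hreindex σ, Finset.sum_const, Finset.card_univ,
    Fintype.card_perm, Fintype.card_fin]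

theorem sum_mul_alternate_ne_zero [LinearOrder R] [IsStrictOrderedRing R] [Fintype V]
    (c : (Fin n → V) → R) {I₀ : Fin n → V} (h : alternate c I₀ ≠ 0) :
    ∑ I, c I * alternate c I ≠ 0 := by
  intro hzero
  have hsum := sum_alternate_sq c
  rw [hzero, smul_zero, Finset.sum_eq_zero_iff_of_nonneg fun _ _ => sq_nonneg _] at hsum
  exact h (pow_eq_zero_iff two_ne_zero |>.1 (hsum I₀ (Finset.mem_univ _)))

end Symmetrization

section ClosedPath

variable {κ : Type*} {n : ℕ}

/-- The edges `I 0, …, I n` of a complete directed graph form a closed path. -/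
def IsClosedPath (I : Fin (n + 1) → κ × κ) : Prop := ∀ t, (I t).2 = (I (t + 1)).1

instance [DecidableEq κ] (I : Fin (n + 1) → κ × κ) : Decidable (IsClosedPath I) :=
  Fintype.decidableForallFintype

/-- The closed path through the vertices `v 0, …, v n`. -/
def closedPath (v : Fin (n + 1) → κ) (t : Fin (n + 1)) : κ × κ := (v t, v (t + 1))

theorem isClosedPath_closedPath (v : Fin (n + 1) → κ) : IsClosedPath (closedPath v) :=
  fun _ => rfl

theorem IsClosedPath.closedPath_eq {I : Fin (n + 1) → κ × κ} (hI : IsClosedPath I) :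
    closedPath (fun t => (I t).1) = I :=
  funext fun t => Prod.ext rfl (hI t).symm

theorem closedPath_injective :
    Function.Injective (closedPath : (Fin (n + 1) → κ) → Fin (n + 1) → κ × κ) :=
  fun _ _ h => funext fun t => congrArg Prod.fst (congrFun h t)

theorem sign_eq_one_of_add_one (hn : Even n) {σ : Equiv.Perm (Fin (n + 1))}
    (hσ : ∀ t, σ (t + 1) = σ t + 1) : Equiv.Perm.sign σ = 1 := by
  have htranslation (t : Fin (n + 1)) : σ t = t + σ 0 := by
    induction t using Fin.induction with
    | zero => rw [zero_add]
    | succ t ih => rw [← Fin.coeSucc_eq_succ, hσ, ih, add_right_comm]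
  have hpow : σ = finRotate (n + 1) ^ (σ 0).val := Equiv.ext fun t => by
    rw [← Equiv.Perm.iterate_eq_pow, ← finCycle_eq_finRotate_iterate, finCycle_apply, htranslation]
  rw [hpow, map_pow, sign_finRotate, Nat.add_sub_cancel, hn.neg_one_pow, one_pow]

variable (R : Type*) [CommRing R]

/-- The indicator function of the closed paths. -/
def closedPathIndicator [DecidableEq κ] (I : Fin (n + 1) → κ × κ) : R :=
  if IsClosedPath I then 1 else 0

theorem alternate_closedPathIndicator_id_pos [LinearOrder R] [IsStrictOrderedRing R]
    (hn : Even n) : 0 < alternate (closedPathIndicator R) (closedPath (id : Fin (n + 1) → _)) := by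
  refine Finset.sum_pos' (fun σ _ => ?_) ⟨1, Finset.mem_univ _, ?_⟩
  · rw [closedPathIndicator]
    split_ifs with h
    · rw [sign_eq_one_of_add_one hn fun t => (h t).symm]
      simp
    · simp
  · simp [closedPathIndicator, isClosedPath_closedPath]

theorem sum_alternate_closedPathIndicator_ne_zero [LinearOrder R] [IsStrictOrderedRing R]
    (hn : Even n) :
    ∑ v : Fin (n + 1) → Fin (n + 1), alternate (closedPathIndicator R) (closedPath v) ≠ 0 := by
  have hsum : ∑ v : Fin (n + 1) → Fin (n + 1), alternate (closedPathIndicator R) (closedPath v) =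
      ∑ I : Fin (n + 1) → Fin (n + 1) × Fin (n + 1),
        closedPathIndicator R I * alternate (closedPathIndicator R) I := by
    refine Fintype.sum_of_injective closedPath closedPath_injective _ _ (fun I hI => ?_) fun v => ?_
    · rw [closedPathIndicator, if_neg fun h => hI ⟨_, h.closedPath_eq⟩, zero_mul]
    · rw [closedPathIndicator, if_pos (isClosedPath_closedPath v), one_mul]
  rw [hsum]
  exact sum_mul_alternate_ne_zero _ (alternate_closedPathIndicator_id_pos R hn).ne'

end ClosedPath

section Units

variable {n : ℕ}

/-- The matrix unit with a one in row `a` and column `b`. -/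
def InfMat.unit (a b : ℕ) : InfMat ℂ where
  entry i j := if i = a ∧ j = b then 1 else 0
  row_finite _ := (Set.finite_singleton b).subset fun _ hj => (ite_ne_right_iff.1 hj).1.2
  col_finite _ := (Set.finite_singleton a).subset fun _ hi => (ite_ne_right_iff.1 hi).1.1

theorem InfMat.unit_entry (a b i j : ℕ) :
    (unit a b).entry i j = if i = a ∧ j = b then 1 else 0 := rfl

theorem InfMat.isFin_unit (a b : ℕ) : (unit a b).IsFin :=
  (Set.finite_singleton (a, b)).subset fun _ hp =>
    Prod.ext_iff.2 (ite_ne_right_iff.1 hp).1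

theorem InfMat.unit_mul_unit (a b c d : ℕ) :
    unit a b * unit c d = if b = c then unit a d else 0 := by
  ext1
  funext i j
  rw [mul_entry_eq_row _ _ _ _ {b} fun l hl => Finset.mem_singleton.2 (ite_ne_right_iff.1 hl).1.2,
    Finset.sum_singleton, apply_ite entry, ite_apply, ite_apply]
  change _ = ite _ _ 0
  simp only [unit_entry, and_true, ite_and, mul_ite, mul_one, mul_zero]
  grind

theorem InfMat.trace_unit (a b : ℕ) : trace id (unit a b) = if b = a then 1 else 0 := by
  rw [trace, finsum_eq_single (fun i => id ((unit a b).entry i i)) a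
    fun i hi => if_neg fun h => hi h.1, id, unit_entry]
  simp only [true_and, eq_comm]

/-- The matrix unit with a one in row `a` and column `b`, as an element of `glFin`. -/
def glFin.unit (a b : ℕ) : glFin := ⟨InfMat.unit a b, isFin_unit a b⟩

variable {N : ℕ}

theorem isLieMatrixUnits_unit : IsLieMatrixUnits fun i j : Fin N => glFin.unit i j := by
  intro a b c d
  refine Subtype.ext ((congrArg₂ (· - ·) (unit_mul_unit a b c d) (unit_mul_unit c d a b)).trans ?_)
  simp only [Fin.val_inj]
  split_ifs <;> rfl

theorem prod_ofFn_unit (I : Fin (n + 1) → Fin N × Fin N) :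
    (List.ofFn fun t => InfMat.unit (I t).1 (I t).2).prod =
      if ∀ t : Fin n, (I t.castSucc).2 = (I t.succ).1 then InfMat.unit (I 0).1 (I (Fin.last n)).2
      else 0 := by
  induction n with
  | zero => simp
  | succ n ih =>
    have hpath : (∀ t : Fin (n + 1), (I t.castSucc).2 = (I t.succ).1) ↔
        (∀ t : Fin n, (I t.succ.castSucc).2 = (I t.succ.succ).1) ∧ (I 0).2 = (I 1).1 :=
      Fin.forall_fin_succ.trans and_comm
    rw [List.ofFn_succ, List.prod_cons, ih fun t => I t.succ, mul_ite, unit_mul_unit, mul_zero,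
      if_congr hpath rfl rfl, ite_and]
    simp only [Fin.val_inj]
    rfl

theorem trace_prod_ofFn_unit (I : Fin (n + 1) → Fin N × Fin N) :
    trace id (List.ofFn fun t => InfMat.unit (I t).1 (I t).2).prod = closedPathIndicator ℂ I := by
  have hclosed : IsClosedPath I ↔
      (∀ t : Fin n, (I t.castSucc).2 = (I t.succ).1) ∧ (I (Fin.last n)).2 = (I 0).1 := by
    simp only [IsClosedPath, Fin.forall_fin_succ', Fin.coeSucc_eq_succ, Fin.last_add_one]
  rw [prod_ofFn_unit, apply_ite (trace id), trace_unit, closedPathIndicator,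
    if_congr hclosed rfl rfl, ite_and]
  simp only [Fin.val_inj]
  congr 1
  exact finsum_eq_zero_of_forall_eq_zero fun _ => rfl

theorem alternateTrace_unit_closedPath (v : Fin (n + 1) → Fin N) :
    (alternateTrace fun t => InfMat.unit (v t) (v (t + 1))) =
      (alternate (closedPathIndicator ℤ) (closedPath v) : ℤ) := by
  refine Eq.trans ?_ (map_alternate (Int.castAddHom ℂ) _ _).symm
  refine Finset.sum_congr rfl fun σ _ => congrArg _ ?_
  refine (trace_prod_ofFn_unit (closedPath v ∘ σ)).trans ?_
  simp only [closedPathIndicator, Int.coe_castAddHom, Int.cast_ite, Int.cast_one, Int.cast_zero]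

theorem exists_isCycle_sum_alternateTrace_ne_zero (hn : Even n) :
    ∃ (m : ℕ) (A : Fin m → Fin (n + 1) → glFin),
      IsCycle A ∧ ∑ i, (alternateTrace fun j => (A i j : InfMat ℂ)) ≠ 0 := by
  let path := (Fintype.equivFin (Fin (n + 1) → Fin (n + 1))).symm
  refine ⟨_, fun i t => glFin.unit (path i t) (path i (t + 1)), ?_, ?_⟩
  · exact (path.sum_comp fun v => boundary fun t => glFin.unit (v t) (v (t + 1))).trans
      (sum_boundary_closedPath isLieMatrixUnits_unit hn)
  · have hcast : ∑ v : Fin (n + 1) → Fin (n + 1),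
        (alternateTrace fun t => InfMat.unit (v t) (v (t + 1))) =
          (∑ v : Fin (n + 1) → Fin (n + 1),
            alternate (closedPathIndicator ℤ) (closedPath v) : ℤ) := by
      simp only [alternateTrace_unit_closedPath, Int.cast_sum]
    exact (path.sum_comp fun v => alternateTrace fun t => InfMat.unit (v t) (v (t + 1))).trans_ne
      (hcast.trans_ne (Int.cast_ne_zero.2 (sum_alternate_closedPathIndicator_ne_zero ℤ hn)))

theorem InfMat.alternateTrace_fin_one (B : Fin 1 → InfMat ℂ) :
    alternateTrace B = trace id (B 0) := by
  simp [alternateTrace, alternate]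

end Units

end

theorem theorem4p3p4 (k : ℕ) (hk : 1 ≤ k) :
    (∃ (m : ℕ) (A : Fin m → Fin (2 * k - 1) → glFin),
      IsCycle A ∧ ∑ i, PsiContracted k (A i) ≠ 0) ∧
    (∀ (m : ℕ) (A : Fin m → Fin (2 * k - 1) → glFin),
      ∑ i, PsiContracted k (A i) =
        -(2 * k + 1 : ℂ) * InfMat.trace id
          (∑ i, alternate (fun B : Fin (2 * k - 1) → InfMat ℂ => (List.ofFn B).prod)
            fun j => (A i j : InfMat ℂ))) ∧
    PsiContracted 1 (fun _ => glFin.E11) = -3 := by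
  obtain ⟨n, rfl⟩ := Nat.exists_eq_add_of_le' hk
  have hsum (m : ℕ) (A : Fin m → Fin (2 * n + 1) → glFin) : ∑ i, PsiContracted (n + 1) (A i) =
      -(2 * (n + 1 : ℕ) + 1 : ℂ) * ∑ i, InfMat.alternateTrace fun j => (A i j : InfMat ℂ) := by
    rw [Finset.mul_sum, Finset.sum_congr rfl fun i _ => PsiContracted_succ n (A i)]
  refine ⟨?_, fun m A => ?_, ?_⟩
  · obtain ⟨m, A, hA, hne⟩ := exists_isCycle_sum_alternateTrace_ne_zero (even_two_mul n)
    refine ⟨m, A, hA, (hsum m A).trans_ne (mul_ne_zero (neg_ne_zero.2 ?_) hne)⟩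
    exact_mod_cast Nat.succ_ne_zero (2 * (n + 1))
  · exact (hsum m A).trans (congrArg _ (trace_sum_alternate_prod (n := 2 * n) _ A).symm)
  · have htrace : InfMat.trace id (glFin.E11 : InfMat ℂ) = 1 := InfMat.trace_unit 0 0
    refine (PsiContracted_succ 0 fun _ => glFin.E11).trans ?_
    rw [InfMat.alternateTrace_fin_one, htrace]
    norm_num
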